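/- Let $J_0$ be the real symmetric Jacobi matrix on $\ell^2(\mathbb N)$, $\mathbb N=\{1,2,\dots\}$, with diagonal entries $b_n^0\in\mathbb R$ and off-diagonal entries $a_n^0>0$ that are 2-periodic ($a_{n+2}^0=a_n^0$, $b_{n+2}^0=b_n^0$), with $a_n^0\neq a_{n+1}^0$. Suppose that $J_0$ has purely continuous spectrum, normalised (by a shift of the spectral parameter) so that $$\sigma(J_0)=\sigma_c(J_0)=[-d,-s]\cup[s,d],\qquad 0<s<d .$$ Let $J$ be a complex Jacobi matrix with diagonal entries $b_n$, lower off-diagonal entries $a_n$ and upper off-diagonal entries $c_n$, i.e. $(Jy)_n=a_{n-1}y_{n-1}+b_ny_n+c_ny_{n+1}$ (with no $y_{n-1}$ term for $n=1$), where $a_nc_n\ne0$, and suppose that $J$ is a compact perturbation of $J_0$: $J$ is bounded and $J-J_0$ is compact on $\ell^2(\mathbb N)$. Put $$d_m=|b_m^0-b_m|+\left|a_{m-1}^0-\frac{a_{m-1}c_{m-1}}{a_{m-1}^0}\right|\quad(m\ge2),\qquad d_1=|b_1^0-b_1| .$$ Let $\nu=b_1^0$, and let $w(\lambda)$, $|w(\lambda)|\le1$,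 be such that $w^2(\lambda)$ is a Floquet multiplier of $J_0$, i.e. the periodic equation $a_{n-1}^0\phi_{n-1}+b_n^0\phi_n+a_n^0\phi_{n+1}=\lambda\phi_n$, $n\ge1$ (with $a_0^0:=a_2^0$), has a nonzero solution with $\phi_{n+2}=w^2(\lambda)\phi_n$ for all $n\ge0$. Let $$K_2(s,d)=\frac{1024\sqrt2\,d^5}{(d-s)^5(d^2-s^2)^{1/2}},$$ and let $t\simeq0.567$ be the unique positive root of $xe^x=1$. If $\sum_{m\ge1}m\,d_m<\infty$ and $$\frac{K_2(s,d)}{1-|w(\nu)|^2}\sum_{m=1}^{\infty}m\,d_m<t,$$ then $J$ has no discrete spectrum: $J$ has no eigenvalues outside $\sigma_c(J_0)$, and no eigenvalue of $J$ of finite algebraic multiplicity is an isolated point of $\sigma(J)$. -/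

import Mathlib

open scoped ENNReal Topology

/-- The Hilbert space `ℓ²` of square summable complex sequences. Sequences are numbered from `0`
throughout, so that the entry with index `n` here is the entry `n + 1` of the usual numbering. -/
abbrev HSeq : Type := lp (fun _ : ℕ => ℂ) 2

/-- A bounded complex Jacobi matrix: `b` is the main diagonal, `a` the lower and `c` the upper
one, and the off-diagonal entries do not vanish. -/
structure JacobiMatrix where
  a : ℕ → ℂ
  b : ℕ → ℂ
  c : ℕ → ℂ
  a_ne_zero : ∀ n, a n ≠ 0
  c_ne_zero : ∀ n, c n ≠ 0
  bounded : ∃ M : ℝ, ∀ n, ‖a n‖ ≤ M ∧ ‖b n‖ ≤ M ∧ ‖c n‖ ≤ M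

/-- The sequence shifted down by one place: `0, y 0, y 1, …`. -/
def shiftDown (y : ℕ → ℂ) : ℕ → ℂ
  | 0 => 0
  | n + 1 => y n

namespace JacobiMatrix

/-- The formal action of a Jacobi matrix on sequences. -/
def act (J : JacobiMatrix) (y : ℕ → ℂ) : ℕ → ℂ
  | 0 => J.b 0 * y 0 + J.c 0 * y 1
  | n + 1 => J.a n * y n + J.b (n + 1) * y (n + 1) + J.c (n + 1) * y (n + 2)

theorem norm_sq_act_le (J : JacobiMatrix) {M : ℝ}
    (hM : ∀ n, ‖J.a n‖ ≤ M ∧ ‖J.b n‖ ≤ M ∧ ‖J.c n‖ ≤ M) (y : ℕ → ℂ) (n : ℕ) :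
    ‖J.act y n‖ ^ 2 ≤
      3 * M ^ 2 * (‖shiftDown y n‖ ^ 2 + ‖y n‖ ^ 2 + ‖y (n + 1)‖ ^ 2) := by
  have hM0 : 0 ≤ M := (norm_nonneg _).trans (hM 0).1
  have key : ‖J.act y n‖ ≤ M * (‖shiftDown y n‖ + ‖y n‖ + ‖y (n + 1)‖) := by
    cases n with
    | zero =>
      refine (norm_add_le _ _).trans ?_
      simp only [norm_mul, shiftDown, norm_zero]
      nlinarith [mul_le_mul_of_nonneg_right (hM 0).2.1 (norm_nonneg (y 0)),
        mul_le_mul_of_nonneg_right (hM 0).2.2 (norm_nonneg (y 1))]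
    | succ n =>
      refine (norm_add₃_le).trans ?_
      simp only [norm_mul, shiftDown]
      nlinarith [mul_le_mul_of_nonneg_right (hM n).1 (norm_nonneg (y n)),
        mul_le_mul_of_nonneg_right (hM (n + 1)).2.1 (norm_nonneg (y (n + 1))),
        mul_le_mul_of_nonneg_right (hM (n + 1)).2.2 (norm_nonneg (y (n + 2)))]
  set p := ‖shiftDown y n‖
  set q := ‖y n‖
  set r := ‖y (n + 1)‖
  calc ‖J.act y n‖ ^ 2 ≤ (M * (p + q + r)) ^ 2 := pow_le_pow_left₀ (norm_nonneg _) key 2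
    _ = M ^ 2 * (p + q + r) ^ 2 := by ring
    _ ≤ M ^ 2 * (3 * (p ^ 2 + q ^ 2 + r ^ 2)) := by
        refine mul_le_mul_of_nonneg_left ?_ (sq_nonneg M)
        nlinarith [sq_nonneg (p - q), sq_nonneg (q - r), sq_nonneg (p - r)]
    _ = _ := by ring

theorem hasSum_normSq (y : HSeq) : HasSum (fun n => ‖y n‖ ^ 2) (‖y‖ ^ 2) := by
  have h := lp.hasSum_norm (p := 2) (by norm_num) y
  simpa using h

theorem act_bound (J : JacobiMatrix) {M : ℝ}
    (hM : ∀ n, ‖J.a n‖ ≤ M ∧ ‖J.b n‖ ≤ M ∧ ‖J.c n‖ ≤ M) (y : HSeq) :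
    Summable (fun n => ‖J.act y n‖ ^ 2) ∧ ∑' n, ‖J.act y n‖ ^ 2 ≤ (3 * M * ‖y‖) ^ 2 := by
  have hy := hasSum_normSq y
  have h1 : HasSum (fun n => ‖shiftDown y n‖ ^ 2) (‖y‖ ^ 2) := by
    rw [← hasSum_nat_add_iff' 1]
    simpa [shiftDown] using hy
  have h3 : HasSum (fun n => ‖y (n + 1)‖ ^ 2) (‖y‖ ^ 2 - ‖y 0‖ ^ 2) := by
    have := (hasSum_nat_add_iff' 1).2 hy
    simpa using this
  have hs := (((h1.add hy).add h3).mul_left (3 * M ^ 2))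
  have hsum : Summable (fun n => ‖J.act y n‖ ^ 2) :=
    Summable.of_nonneg_of_le (fun n => sq_nonneg _) (J.norm_sq_act_le hM y) hs.summable
  refine ⟨hsum, ?_⟩
  calc ∑' n, ‖J.act y n‖ ^ 2 ≤ _ := hasSum_le (J.norm_sq_act_le hM y) hsum.hasSum hs
    _ ≤ _ := by nlinarith [sq_nonneg M, mul_nonneg (sq_nonneg M) (sq_nonneg ‖y 0‖)]

theorem memℓp_act (J : JacobiMatrix) (y : HSeq) : Memℓp (J.act y) 2 := by
  obtain ⟨M, hM⟩ := J.bounded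
  refine memℓp_gen ?_
  simpa using (J.act_bound hM y).1

/-- The Jacobi matrix as a linear map on `ℓ²`. -/
def opLinear (J : JacobiMatrix) : HSeq →ₗ[ℂ] HSeq where
  toFun y := ⟨J.act y, J.memℓp_act y⟩
  map_add' x y := by
    ext n
    change J.act (⇑x + ⇑y) n = J.act x n + J.act y n
    cases n <;> simp only [act, Pi.add_apply] <;> ring
  map_smul' r y := by
    ext n
    change J.act (r • ⇑y) n = r * J.act y n
    cases n <;> simp only [act, Pi.smul_apply, smul_eq_mul] <;> ring

/-- The bounded operator on `ℓ²` generated by a Jacobi matrix. -/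
def op (J : JacobiMatrix) : HSeq →L[ℂ] HSeq :=
  ⟨J.opLinear, by
    obtain ⟨M, hM⟩ := J.bounded
    have hM0 : 0 ≤ M := (norm_nonneg _).trans (hM 0).1
    refine AddMonoidHomClass.continuous_of_bound J.opLinear (3 * M) fun y => ?_
    refine (sq_le_sq₀ (norm_nonneg _) (by positivity)).1 ?_
    rw [← (hasSum_normSq (J.opLinear y)).tsum_eq]
    exact (J.act_bound hM y).2⟩

theorem op_apply (J : JacobiMatrix) (y : HSeq) (n : ℕ) : J.op y n = J.act y n := rfl

end JacobiMatrix

/-- A real symmetric Jacobi matrix with `2`-periodic entries: `b` is the main diagonal, and `a`,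
which is positive, both neighbouring diagonals. -/
structure PeriodicJacobi where
  a : ℕ → ℝ
  b : ℕ → ℝ
  a_pos : ∀ n, 0 < a n
  a_periodic : ∀ n, a (n + 2) = a n
  b_periodic : ∀ n, b (n + 2) = b n

namespace PeriodicJacobi

theorem abs_le_of_periodic (f : ℕ → ℝ) (hf : ∀ n, f (n + 2) = f n) (n : ℕ) :
    |f n| ≤ |f 0| + |f 1| := by
  induction n using Nat.strong_induction_on with
  | _ n ih =>
    match n with
    | 0 => linarith [abs_nonneg (f 1)]
    | 1 => linarith [abs_nonneg (f 0)]
    | k + 2 => rw [hf]; exact ih k (by omega)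

/-- A periodic matrix as a complex Jacobi matrix. -/
def toJacobi (P : PeriodicJacobi) : JacobiMatrix where
  a n := (P.a n : ℂ)
  b n := (P.b n : ℂ)
  c n := (P.a n : ℂ)
  a_ne_zero n := by exact_mod_cast (P.a_pos n).ne'
  c_ne_zero n := by exact_mod_cast (P.a_pos n).ne'
  bounded := by
    refine ⟨max (|P.a 0| + |P.a 1|) (|P.b 0| + |P.b 1|), fun n => ?_⟩
    have ha := abs_le_of_periodic P.a P.a_periodic n
    have hb := abs_le_of_periodic P.b P.b_periodic n
    simp only [Complex.norm_real, Real.norm_eq_abs]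
    exact ⟨le_max_of_le_left ha, le_max_of_le_right hb, le_max_of_le_left ha⟩

/-- The bounded operator on `ℓ²` generated by a periodic Jacobi matrix. -/
def op (P : PeriodicJacobi) : HSeq →L[ℂ] HSeq := P.toJacobi.op

/-- `ρ` is a multiplier of the periodic difference equation at `z`: some nonzero solution `φ` of
the three-term equation is multiplied by `ρ` under translation by the period. Here `φ` has one
more initial term than the vectors of `ℓ²`: the term `φ (n + 1)` belongs to row `n`, and the
coefficient of `φ 0` in row `0` is, by periodicity, `a 1`. -/
def IsFloquetMultiplier (P : PeriodicJacobi) (z ρ : ℂ) : Prop :=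
  ∃ φ : ℕ → ℂ, φ ≠ 0 ∧
    (∀ n, (P.a (n + 1) : ℂ) * φ n + (P.b n : ℂ) * φ (n + 1) + (P.a n : ℂ) * φ (n + 2)
      = z * φ (n + 1)) ∧
    ∀ n, φ (n + 2) = ρ * φ n

/-- The size of the perturbation in each row:
`|b⁰ₙ - bₙ| + |a⁰ₙ₋₁ - aₙ₋₁ cₙ₋₁ / a⁰ₙ₋₁|`, where the second term is absent in the first row. -/
noncomputable def perturbation (P : PeriodicJacobi) (J : JacobiMatrix) : ℕ → ℝ
  | 0 => ‖(P.b 0 : ℂ) - J.b 0‖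
  | n + 1 => ‖(P.b (n + 1) : ℂ) - J.b (n + 1)‖ +
      ‖(P.a n : ℂ) - J.a n * J.c n / (P.a n : ℂ)‖

end PeriodicJacobi

/-- The continuous spectrum: `T - z` is injective with dense range, but not onto. -/
def continuousSpectrum (T : HSeq →L[ℂ] HSeq) : Set ℂ :=
  {z | Function.Injective (T - z • (1 : HSeq →L[ℂ] HSeq)) ∧
    DenseRange (T - z • (1 : HSeq →L[ℂ] HSeq)) ∧
    ¬ Function.Surjective (T - z • (1 : HSeq →L[ℂ] HSeq))}

/-- The discrete spectrum: eigenvalues of finite algebraic multiplicity which are isolated points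
of the spectrum. -/
def discreteSpectrum (T : HSeq →L[ℂ] HSeq) : Set ℂ :=
  {z | Module.End.HasEigenvalue (T : HSeq →ₗ[ℂ] HSeq) z ∧
    FiniteDimensional ℂ (Module.End.maxGenEigenspace (T : HSeq →ₗ[ℂ] HSeq) z) ∧
    ∀ᶠ x in 𝓝[≠] z, x ∉ spectrum ℂ T}

/-- The constant `1024 √2 d⁵ / ((d - s)⁵ (d² - s²)^{1/2})`. -/
noncomputable def constK₂ (s d : ℝ) : ℝ :=
  1024 * √2 * d ^ 5 / ((d - s) ^ 5 * √(d ^ 2 - s ^ 2))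

/-! Eigenvalues off the bands are excluded by a Green function argument. Multiplying an
eigensequence of `J` by the products of `J.c k / P.a k` (`gauge`) turns its upper diagonal into that
of the periodic matrix and its lower one into `J.a n * J.c n / P.a n`. The result `X` solves the
periodic equation with a right-hand side bounded, row by row, by `perturbation` times the larger of
two neighbouring entries of `X` (`exists_solves`).

Off the bands the multiplier `ω ^ 2` lies inside the unit disc. Variation of constants uses the
regular solution `p`, which vanishes at the boundary, and the decaying Floquet solution `ψ`. Its
kernel is a product of `p` at the smaller index and `ψ` at the larger one, divided by `P.a 1`; it
grows at most linearly in the smaller index, with a constant independent of the spectral parameter.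
The first moment of the perturbation therefore bounds the resulting operator in a sup norm with
weight `q ^ n`, and if the bound is below `1` then `X = 0` (`Solves.eq_zero`). The weight is needed
because the gauge may grow; compactness forces `J.c n - P.a n → 0`, so this growth is slower than `q
^ n` for every `q > 1`, and `q < ‖ω‖⁻¹` is enough.

The constants come from the spectrum of the periodic matrix: purity gives `P.a 1 ≤ P.a 0`, the band
ends determine the remaining relations (`parameters_of_bands`), and `‖w ν‖ ^ 2 = P.a 1 / P.a 0`. The
stated `constK₂` then dominates the Green constant with much to spare (`green_constant_le`), so only
`t < 1` is used.

Inside the bands, the Fredholm alternative keeps every point in the spectrum of `J`, so no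
eigenvalue there is isolated. -/

/-! ### Explicit solutions of the periodic equation and their bounds. -/

/-- The sequence with even entries `e` and odd entries `o`. -/
def interleave (e o : ℕ → ℂ) (n : ℕ) : ℂ := if n % 2 = 0 then e (n / 2) else o (n / 2)

@[simp] theorem interleave_even (e o : ℕ → ℂ) (k : ℕ) : interleave e o (2 * k) = e k := by
  simp [interleave]

@[simp] theorem interleave_odd (e o : ℕ → ℂ) (k : ℕ) : interleave e o (2 * k + 1) = o k := by
  have h : (2 * k + 1) / 2 = k := by omega
  simp [interleave, h]

/-- The numbers `(ρ ^ k - ρ ^ (-k)) / (ρ - ρ⁻¹)`, defined so as to make sense for `ρ ^ 2 = 1`. -/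
noncomputable def multiplierSum (ρ : ℂ) : ℕ → ℂ
  | 0 => 0
  | k + 1 => ρ * multiplierSum ρ k + ρ⁻¹ ^ k

theorem multiplierSum_add_two {ρ : ℂ} (hρ : ρ ≠ 0) (k : ℕ) :
    multiplierSum ρ (k + 2) = (ρ + ρ⁻¹) * multiplierSum ρ (k + 1) - multiplierSum ρ k := by
  have h : multiplierSum ρ (k + 2) = ρ * multiplierSum ρ (k + 1) + ρ⁻¹ ^ (k + 1) := rfl
  have h' : multiplierSum ρ (k + 1) = ρ * multiplierSum ρ k + ρ⁻¹ ^ k := rfl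
  have h'' : ρ⁻¹ * multiplierSum ρ (k + 1) = multiplierSum ρ k + ρ⁻¹ ^ (k + 1) := by
    rw [h', pow_succ]
    field_simp
  linear_combination h - h''

/-- `multiplierSum ρ k` is a sum of `k` powers of `ρ` with exponents at least `1 - k`, so after
scaling by `ρ ^ k` each term keeps at least one factor `ρ`. That spare factor later absorbs a large
spectral parameter. -/
theorem norm_multiplierSum_le {ρ : ℂ} (hρ : ρ ≠ 0) (h1 : ‖ρ‖ ≤ 1) (k : ℕ) :
    ‖multiplierSum ρ k‖ * ‖ρ‖ ^ k ≤ k * ‖ρ‖ := by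
  have hr : 0 < ‖ρ‖ := norm_pos_iff.2 hρ
  induction k with
  | zero => simp [multiplierSum]
  | succ k ih =>
    have h : ‖multiplierSum ρ (k + 1)‖ ≤ ‖ρ‖ * ‖multiplierSum ρ k‖ + ‖ρ‖⁻¹ ^ k := by
      refine (norm_add_le _ _).trans_eq ?_
      rw [norm_mul, norm_pow, norm_inv]
    have hc : ‖ρ‖⁻¹ ^ k * ‖ρ‖ ^ k = 1 := by
      rw [← mul_pow, inv_mul_cancel₀ hr.ne', one_pow]
    calc ‖multiplierSum ρ (k + 1)‖ * ‖ρ‖ ^ (k + 1)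
        ≤ (‖ρ‖ * ‖multiplierSum ρ k‖ + ‖ρ‖⁻¹ ^ k) * ‖ρ‖ ^ (k + 1) := by gcongr
      _ = ‖ρ‖ * ‖ρ‖ * (‖multiplierSum ρ k‖ * ‖ρ‖ ^ k) + (‖ρ‖⁻¹ ^ k * ‖ρ‖ ^ k) * ‖ρ‖ := by ring
      _ ≤ 1 * (k * ‖ρ‖) + 1 * ‖ρ‖ := by
          rw [hc]
          have : ‖ρ‖ * ‖ρ‖ ≤ 1 := by nlinarith
          gcongr
      _ = _ := by push_cast; ring

namespace PeriodicJacobi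

variable (P : PeriodicJacobi)

theorem a_even (k : ℕ) : P.a (2 * k) = P.a 0 := by
  induction k with
  | zero => rfl
  | succ k ih => rw [← ih, ← P.a_periodic (2 * k)]; rfl

theorem a_odd (k : ℕ) : P.a (2 * k + 1) = P.a 1 := by
  induction k with
  | zero => rfl
  | succ k ih => rw [← ih, ← P.a_periodic (2 * k + 1)]; rfl

theorem b_even (k : ℕ) : P.b (2 * k) = P.b 0 := by
  induction k with
  | zero => rfl
  | succ k ih => rw [← ih, ← P.b_periodic (2 * k)]; rfl

theorem b_odd (k : ℕ) : P.b (2 * k + 1) = P.b 1 := by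
  induction k with
  | zero => rfl
  | succ k ih => rw [← ih, ← P.b_periodic (2 * k + 1)]; rfl

/-- `X` solves the inhomogeneous periodic equation at `z` with right hand side `v`. As in
`IsFloquetMultiplier`, the sequence `X` has one more initial term than `v`. -/
def Solves (z : ℂ) (X v : ℕ → ℂ) : Prop :=
  ∀ n, (P.a (n + 1) : ℂ) * X n + ((P.b n : ℂ) - z) * X (n + 1) + (P.a n : ℂ) * X (n + 2) = v n

theorem solves_of_rows {z : ℂ} {X v : ℕ → ℂ}
    (he : ∀ k, (P.a 1 : ℂ) * X (2 * k) + ((P.b 0 : ℂ) - z) * X (2 * k + 1) +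
      (P.a 0 : ℂ) * X (2 * (k + 1)) = v (2 * k))
    (ho : ∀ k, (P.a 0 : ℂ) * X (2 * k + 1) + ((P.b 1 : ℂ) - z) * X (2 * (k + 1)) +
      (P.a 1 : ℂ) * X (2 * (k + 1) + 1) = v (2 * k + 1)) : P.Solves z X v := by
  intro n
  obtain ⟨k, rfl | rfl⟩ := Nat.even_or_odd' n
  · rw [a_odd, b_even, a_even]
    exact he k
  · rw [show 2 * k + 1 + 1 = 2 * (k + 1) by ring, a_even, b_odd, a_odd]
    exact ho k

/-- The characteristic equation for the multipliers of the periodic equation. -/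
def IsCharRoot (z ρ : ℂ) : Prop :=
  (z - P.b 0) * (z - P.b 1) * ρ = (P.a 0 + P.a 1 * ρ) * (P.a 1 + P.a 0 * ρ)

/-- Two consecutive rows give a homogeneous linear system for `φ 0` and `φ 1`. The characteristic
equation says that its determinant vanishes; otherwise both values, and by quasi-periodicity all of
`φ`, would be zero. -/
theorem IsFloquetMultiplier.isCharRoot {P : PeriodicJacobi} {z ρ : ℂ}
    (h : P.IsFloquetMultiplier z ρ) : P.IsCharRoot z ρ := by
  obtain ⟨φ, hφ, heq, hper⟩ := h
  have ha0 : (P.a 0 : ℂ) ≠ 0 := by exact_mod_cast (P.a_pos 0).ne'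
  have ha1 : (P.a 1 : ℂ) ≠ 0 := by exact_mod_cast (P.a_pos 1).ne'
  have h0 := heq 0
  have h1 := heq 1
  have p0 := hper 0
  have p1 := hper 1
  rw [P.a_periodic 0] at h1
  simp only [zero_add, Nat.reduceAdd] at h0 h1 p0 p1
  rw [p0] at h0 h1
  rw [p1] at h1
  have e0 : (P.a 1 + P.a 0 * ρ) * φ 0 = (z - P.b 0) * φ 1 := by linear_combination h0
  have e1 : (P.a 0 + P.a 1 * ρ) * φ 1 = (z - P.b 1) * ρ * φ 0 := by linear_combination h1
  by_contra hne
  have z0 : φ 0 = 0 := by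
    have : ((z - P.b 0) * (z - P.b 1) * ρ - (P.a 0 + P.a 1 * ρ) * (P.a 1 + P.a 0 * ρ)) * φ 0 = 0 := by
      linear_combination -(P.a 0 + P.a 1 * ρ) * e0 - (z - P.b 0) * e1
    exact (mul_eq_zero.1 this).resolve_left (sub_ne_zero.2 hne)
  have z1 : φ 1 = 0 := by
    have : ((z - P.b 0) * (z - P.b 1) * ρ - (P.a 0 + P.a 1 * ρ) * (P.a 1 + P.a 0 * ρ)) * φ 1 = 0 := by
      linear_combination -(P.a 1 + P.a 0 * ρ) * e1 - (z - P.b 1) * ρ * e0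
    exact (mul_eq_zero.1 this).resolve_left (sub_ne_zero.2 hne)
  refine hφ (funext fun n => ?_)
  induction n using Nat.strong_induction_on with
  | _ n ih =>
    match n with
    | 0 => exact z0
    | 1 => exact z1
    | k + 2 => rw [hper, ih k (by omega)]; simp

variable {P}

theorem IsCharRoot.ne_zero {z ρ : ℂ} (h : P.IsCharRoot z ρ) : ρ ≠ 0 := by
  rintro rfl
  have ha0 : (P.a 0 : ℂ) ≠ 0 := by exact_mod_cast (P.a_pos 0).ne'
  have ha1 : (P.a 1 : ℂ) ≠ 0 := by exact_mod_cast (P.a_pos 1).ne'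
  simp [IsCharRoot, ha0, ha1] at h

/-- The solution of the homogeneous equation with initial values `0` and `1`. -/
noncomputable def regularSolution (P : PeriodicJacobi) (z ρ : ℂ) : ℕ → ℂ :=
  interleave (fun k => (z - P.b 0) / P.a 0 * multiplierSum ρ k)
    (fun k => multiplierSum ρ (k + 1) + P.a 1 / P.a 0 * multiplierSum ρ k)

/-- The solution of the homogeneous equation with multiplier `ρ` and initial value `1`. -/
noncomputable def floquetSolution (P : PeriodicJacobi) (z ρ : ℂ) : ℕ → ℂ :=
  interleave (fun k => ρ ^ k) (fun k => (z - P.b 1) * ρ ^ (k + 1) / (P.a 0 + P.a 1 * ρ))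

@[simp] theorem regularSolution_zero (z ρ : ℂ) : P.regularSolution z ρ 0 = 0 := by
  simp [regularSolution, interleave, multiplierSum]

@[simp] theorem regularSolution_one (z ρ : ℂ) : P.regularSolution z ρ 1 = 1 := by
  simp [regularSolution, interleave, multiplierSum]

@[simp] theorem floquetSolution_zero (z ρ : ℂ) : P.floquetSolution z ρ 0 = 1 := by
  simp [floquetSolution, interleave]

theorem IsCharRoot.solves_regularSolution {z ρ : ℂ} (h : P.IsCharRoot z ρ) :
    P.Solves z (P.regularSolution z ρ) 0 := by
  have ha0 : (P.a 0 : ℂ) ≠ 0 := by exact_mod_cast (P.a_pos 0).ne'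
  have hρ := h.ne_zero
  refine P.solves_of_rows (fun k => ?_) fun k => ?_
  · simp only [regularSolution, interleave_even, interleave_odd, Pi.zero_apply]
    field_simp
    ring
  · simp only [regularSolution, interleave_even, interleave_odd, Pi.zero_apply]
    rw [multiplierSum_add_two hρ]
    unfold IsCharRoot at h
    field_simp
    linear_combination -multiplierSum ρ (k + 1) * h

theorem IsCharRoot.solves_floquetSolution {z ρ : ℂ} (h : P.IsCharRoot z ρ)
    (h0 : (P.a 0 + P.a 1 * ρ : ℂ) ≠ 0) : P.Solves z (P.floquetSolution z ρ) 0 := by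
  refine P.solves_of_rows (fun k => ?_) fun k => ?_
  · simp only [floquetSolution, interleave_even, interleave_odd, Pi.zero_apply]
    unfold IsCharRoot at h
    field_simp
    linear_combination -ρ ^ k * h
  · simp only [floquetSolution, interleave_even, interleave_odd, Pi.zero_apply]
    field_simp
    ring

theorem norm_add_mul_ge {ρ : ℂ} (h1 : ‖ρ‖ ≤ 1) :
    P.a 0 - P.a 1 ≤ ‖(P.a 0 + P.a 1 * ρ : ℂ)‖ := by
  have h := norm_sub_norm_le (P.a 0 : ℂ) (-(P.a 1 * ρ))
  rw [norm_neg, norm_mul, Complex.norm_real, Complex.norm_real, Real.norm_of_nonneg (P.a_pos 0).le,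
    Real.norm_of_nonneg (P.a_pos 1).le, sub_neg_eq_add] at h
  nlinarith [P.a_pos 1]

/-- The entries of the matrix and of the spectral parameter are controlled by the end of the upper
band. -/
theorem IsCharRoot.norm_mul_le {z ω : ℂ} {d : ℝ} (h : P.IsCharRoot z (ω ^ 2))
    (h1 : ‖ω‖ ≤ 1) (hd : 0 ≤ d) (hb : P.b 1 = -P.b 0)
    (hd2 : d ^ 2 = P.b 0 ^ 2 + (P.a 0 + P.a 1) ^ 2) : ‖z‖ * ‖ω‖ ≤ d := by
  have hω : ω ≠ 0 := by
    rintro rfl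
    exact h.ne_zero (by simp)
  -- Multiplying `z` by `ω` clears the pole at `ω = 0`: the right-hand side is a polynomial in `ω`
  -- with nonnegative coefficients, hence largest in modulus on the closed disc at `ω = 1`, where it
  -- equals `d ^ 2`.
  have e : (z * ω) ^ 2 = P.b 0 ^ 2 * ω ^ 2 + (P.a 0 + P.a 1 * ω ^ 2) * (P.a 1 + P.a 0 * ω ^ 2) := by
    unfold IsCharRoot at h
    rw [hb] at h
    push_cast at h
    linear_combination h
  have n0 : ‖(P.a 0 + P.a 1 * ω ^ 2 : ℂ)‖ ≤ P.a 0 + P.a 1 * ‖ω‖ ^ 2 := by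
    refine (norm_add_le _ _).trans_eq ?_
    simp [abs_of_pos (P.a_pos _)]
  have n1 : ‖(P.a 1 + P.a 0 * ω ^ 2 : ℂ)‖ ≤ P.a 1 + P.a 0 * ‖ω‖ ^ 2 := by
    refine (norm_add_le _ _).trans_eq ?_
    simp [abs_of_pos (P.a_pos _)]
  have p0 := P.a_pos 0
  have p1 := P.a_pos 1
  have hs : ‖ω‖ ^ 2 ≤ 1 := pow_le_one₀ (norm_nonneg _) h1
  refine abs_le_of_sq_le_sq' ?_ hd |>.2
  calc (‖z‖ * ‖ω‖) ^ 2 = ‖(z * ω) ^ 2‖ := by simp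
    _ ≤ ‖(P.b 0 ^ 2 * ω ^ 2 : ℂ)‖ + ‖(P.a 0 + P.a 1 * ω ^ 2 : ℂ)‖ * ‖(P.a 1 + P.a 0 * ω ^ 2 : ℂ)‖ := by
        rw [e, ← norm_mul]
        exact norm_add_le _ _
    _ ≤ P.b 0 ^ 2 * 1 + (P.a 0 + P.a 1 * 1) * (P.a 1 + P.a 0 * 1) := by
        have : ‖(P.b 0 ^ 2 * ω ^ 2 : ℂ)‖ = P.b 0 ^ 2 * ‖ω‖ ^ 2 := by simp
        rw [this]
        have n0' : ‖(P.a 0 + P.a 1 * ω ^ 2 : ℂ)‖ ≤ P.a 0 + P.a 1 * 1 := n0.trans (by gcongr)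
        have n1' : ‖(P.a 1 + P.a 0 * ω ^ 2 : ℂ)‖ ≤ P.a 1 + P.a 0 * 1 := n1.trans (by gcongr)
        gcongr
    _ = d ^ 2 := by rw [hd2]; ring

section bounds

variable {z ω : ℂ} {d : ℝ}

theorem norm_sub_mul_le (hzω : ‖z‖ * ‖ω‖ ≤ d) (h1 : ‖ω‖ ≤ 1) {x : ℝ} (hx : |x| ≤ d) :
    ‖z - x‖ * ‖ω‖ ≤ 2 * d := by
  have h : ‖z - x‖ ≤ ‖z‖ + |x| := by
    simpa using norm_sub_le z (x : ℂ)
  nlinarith [norm_nonneg ω, abs_nonneg x]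

/-- Once the exponential factor is scaled out only linear growth remains, uniformly up to `‖ω‖ = 1`.
In even entries one of the two spare factors `ω` absorbs `z - P.b 0`; in odd entries the two sums
contribute `k + 1` and `k`. -/
theorem norm_regularSolution_mul_le (h : P.IsCharRoot z (ω ^ 2)) (h1 : ‖ω‖ ≤ 1)
    (hzω : ‖z‖ * ‖ω‖ ≤ d) (hb : |P.b 0| ≤ d) (ha : P.a 0 ≤ d) (hlt : P.a 1 < P.a 0) (i : ℕ) :
    ‖P.regularSolution z (ω ^ 2) i‖ * ‖ω‖ ^ i ≤ d / P.a 0 * i := by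
  have p0 := P.a_pos 0
  have hn : ‖ω ^ 2‖ = ‖ω‖ ^ 2 := norm_pow _ _
  have hs : ‖ω‖ ^ 2 ≤ 1 := pow_le_one₀ (norm_nonneg _) h1
  have hV := norm_multiplierSum_le h.ne_zero (hn.le.trans hs)
  rw [hn] at hV
  have hω : 0 < ‖ω‖ := norm_pos_iff.2 (by rintro rfl; exact h.ne_zero (by simp))
  obtain ⟨k, rfl | rfl⟩ := Nat.even_or_odd' i
  · rw [regularSolution, interleave_even, norm_mul, norm_div, Complex.norm_real,
      Real.norm_of_nonneg p0.le, pow_mul]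
    calc _ = ‖z - P.b 0‖ / P.a 0 * (‖multiplierSum (ω ^ 2) k‖ * (‖ω‖ ^ 2) ^ k) := by ring
      _ ≤ ‖z - P.b 0‖ / P.a 0 * (k * ‖ω‖ ^ 2) :=
          mul_le_mul_of_nonneg_left (hV k) (by positivity)
      _ = (‖z - P.b 0‖ * ‖ω‖) * ‖ω‖ * (k / P.a 0) := by ring
      _ ≤ 2 * d * 1 * (k / P.a 0) := by
          have := norm_sub_mul_le hzω h1 hb
          have hd : 0 ≤ d := (abs_nonneg _).trans hb
          gcongr
      _ = _ := by push_cast; ring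
  · rw [regularSolution, interleave_odd]
    have hle : ‖(P.a 1 / P.a 0 * multiplierSum (ω ^ 2) k : ℂ)‖ ≤ ‖multiplierSum (ω ^ 2) k‖ := by
      rw [norm_mul, norm_div, Complex.norm_real, Complex.norm_real,
        Real.norm_of_nonneg p0.le, Real.norm_of_nonneg (P.a_pos 1).le]
      exact mul_le_of_le_one_left (norm_nonneg _) ((div_le_one p0).2 hlt.le)
    have hk1 : ‖multiplierSum (ω ^ 2) (k + 1)‖ * (‖ω‖ ^ 2) ^ k ≤ k + 1 := by
      have := hV (k + 1)
      rw [pow_succ (‖ω‖ ^ 2), ← mul_assoc] at this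
      have := le_of_mul_le_mul_right this (by positivity)
      simpa using this
    calc _ ≤ (‖multiplierSum (ω ^ 2) (k + 1)‖ + ‖multiplierSum (ω ^ 2) k‖) * ‖ω‖ ^ (2 * k + 1) := by
          gcongr
          exact (norm_add_le _ _).trans (by gcongr)
      _ = (‖multiplierSum (ω ^ 2) (k + 1)‖ * (‖ω‖ ^ 2) ^ k +
            ‖multiplierSum (ω ^ 2) k‖ * (‖ω‖ ^ 2) ^ k) * ‖ω‖ := by ring
      _ ≤ ((k + 1) + k * 1) * 1 := by
          have : ‖multiplierSum (ω ^ 2) k‖ * (‖ω‖ ^ 2) ^ k ≤ k * 1 := (hV k).trans (by gcongr)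
          gcongr ?_ * ?_
          exact add_le_add hk1 this
      _ = 1 * ((2 * k + 1 : ℕ) : ℝ) := by push_cast; ring
      _ ≤ _ := by
          gcongr
          exact (one_le_div p0).2 ha

/-- An odd entry `2 * k + 1` carries `ω ^ (2 * k + 2)`, one power more than needed, and this absorbs
`z - P.b 1`. The denominator stays away from zero because `P.a 1 < P.a 0`. -/
theorem norm_floquetSolution_le (h1 : ‖ω‖ ≤ 1)
    (hzω : ‖z‖ * ‖ω‖ ≤ d) (hb : |P.b 1| ≤ d) (ha : P.a 0 ≤ d) (hlt : P.a 1 < P.a 0) (j : ℕ) :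
    ‖P.floquetSolution z (ω ^ 2) j‖ ≤ 2 * d / (P.a 0 - P.a 1) * ‖ω‖ ^ j := by
  have p1 := P.a_pos 1
  have hs : ‖ω ^ 2‖ ≤ 1 := by rw [norm_pow]; exact pow_le_one₀ (norm_nonneg _) h1
  have hpos : 0 < P.a 0 - P.a 1 := sub_pos.2 hlt
  obtain ⟨k, rfl | rfl⟩ := Nat.even_or_odd' j
  · rw [floquetSolution, interleave_even, norm_pow, norm_pow, ← pow_mul]
    refine le_mul_of_one_le_left (by positivity) ((one_le_div hpos).2 ?_)
    linarith
  · rw [floquetSolution, interleave_odd, norm_div, norm_mul, norm_pow, norm_pow]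
    calc _ ≤ ‖z - P.b 1‖ * (‖ω‖ ^ 2) ^ (k + 1) / (P.a 0 - P.a 1) := by
          gcongr
          exact norm_add_mul_ge hs
      _ = (‖z - P.b 1‖ * ‖ω‖) * ‖ω‖ ^ (2 * k + 1) / (P.a 0 - P.a 1) := by ring
      _ ≤ (2 * d) * ‖ω‖ ^ (2 * k + 1) / (P.a 0 - P.a 1) := by
          have := norm_sub_mul_le hzω h1 hb
          gcongr
      _ = _ := by ring

end bounds

end PeriodicJacobi

/-! ### Green's identity, variation of constants and the weighted contraction. -/

namespace PeriodicJacobi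

/-- The Wronskian of two sequences. -/
def wronskian (P : PeriodicJacobi) (X Y : ℕ → ℂ) (n : ℕ) : ℂ :=
  P.a (n + 1) * (X n * Y (n + 1) - X (n + 1) * Y n)

section Green

variable {P : PeriodicJacobi} {z : ℂ} {p ψ X v : ℕ → ℂ}

/-- Green's identity: cross-multiplying the two equations cancels the diagonal terms, and what
remains telescopes. -/
theorem Solves.sum_Ico (hp : P.Solves z p 0) (hX : P.Solves z X v) {n N : ℕ} (h : n ≤ N) :
    ∑ m ∈ Finset.Ico n N, p (m + 1) * v m = P.wronskian p X N - P.wronskian p X n := by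
  rw [← Finset.sum_Ico_sub (P.wronskian p X) h]
  refine Finset.sum_congr rfl fun m _ => ?_
  have e1 := hp m
  have e2 := hX m
  rw [Pi.zero_apply] at e1
  simp only [wronskian]
  rw [show m + 1 + 1 = m + 2 by ring, P.a_periodic]
  linear_combination -p (m + 1) * e2 + X (m + 1) * e1

/-- The values of a solution of the inhomogeneous equation expressed by two solutions of the
homogeneous one. -/
theorem Solves.representation (hp : P.Solves z p 0) (hp0 : p 0 = 0) (hp1 : p 1 = 1)
    (hψ : P.Solves z ψ 0) (hψ0 : ψ 0 = 1) (hX : P.Solves z X v) (hX0 : X 0 = 0)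
    {n N : ℕ} (h : n ≤ N) :
    (P.a 1 : ℂ) * X n = -(ψ n * ∑ m ∈ Finset.Ico 0 n, p (m + 1) * v m +
      p n * (∑ m ∈ Finset.Ico n N, ψ (m + 1) * v m - P.wronskian ψ X N)) := by
  -- The Wronskian of two homogeneous solutions is constant; its value is read off at index `0`.
  have hW : P.wronskian p ψ n = -P.a 1 := by
    have := hp.sum_Ico hψ (Nat.zero_le n)
    simp [wronskian, hp0, hp1, hψ0] at this
    rw [wronskian]
    linear_combination -this
  have h0 : P.wronskian p X 0 = 0 := by simp [wronskian, hp0, hX0]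
  rw [hp.sum_Ico hX (Nat.zero_le n), hψ.sum_Ico hX h, h0]
  unfold wronskian at hW ⊢
  linear_combination X n * hW

variable {A B θ q M : ℝ} {D : ℕ → ℝ}

theorem tendsto_wronskian_zero (hθ : 0 < θ) (hq : 1 ≤ q) (hθq : θ * q < 1)
    (hψb : ∀ j, ‖ψ j‖ ≤ B * θ ^ j) (hXb : ∀ n, ‖X n‖ ≤ M * q ^ n) :
    Filter.Tendsto (P.wronskian ψ X) Filter.atTop (𝓝 0) := by
  have hB : 0 ≤ B := by simpa using (norm_nonneg _).trans (hψb 0)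
  have hM : 0 ≤ M := by simpa using (norm_nonneg _).trans (hXb 0)
  have hq0 : 0 ≤ q := zero_le_one.trans hq
  refine squeeze_zero_norm (a := fun n =>
    (P.a 0 + P.a 1) * (B * M * (q + θ)) * (θ * q) ^ n) (fun n => ?_) ?_
  · have ha : P.a (n + 1) ≤ P.a 0 + P.a 1 := by
      have := abs_le_of_periodic P.a P.a_periodic (n + 1)
      rwa [abs_of_pos (P.a_pos _), abs_of_pos (P.a_pos _), abs_of_pos (P.a_pos _)] at this
    rw [wronskian, norm_mul, Complex.norm_real, Real.norm_of_nonneg (P.a_pos _).le, mul_assoc]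
    have h1 : ‖ψ n * X (n + 1) - ψ (n + 1) * X n‖ ≤ B * M * (q + θ) * (θ * q) ^ n := by
      refine (norm_sub_le _ _).trans ?_
      rw [norm_mul, norm_mul]
      calc _ ≤ (B * θ ^ n) * (M * q ^ (n + 1)) + (B * θ ^ (n + 1)) * (M * q ^ n) := by
            gcongr
            exacts [hψb _, hXb _, hψb _, hXb _]
        _ = _ := by rw [mul_pow]; ring
    have hs : 0 ≤ P.a 0 + P.a 1 := (P.a_pos 0).le.trans (by linarith [P.a_pos 1])
    gcongr
  · have := tendsto_pow_atTop_nhds_zero_of_lt_one (mul_nonneg hθ.le hq0) hθq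
    simpa using this.const_mul ((P.a 0 + P.a 1) * (B * M * (q + θ)))

/-- A bound `M * q ^ n` improves by the factor `A * B / P.a 1` times the first moment. Either half
of the kernel costs at most `m + 1`, and the boundary term at `N` disappears as `N → ∞`. -/
theorem Solves.norm_le (hp : P.Solves z p 0) (hp0 : p 0 = 0) (hp1 : p 1 = 1)
    (hψ : P.Solves z ψ 0) (hψ0 : ψ 0 = 1) (hX : P.Solves z X v) (hX0 : X 0 = 0)
    (hθ : 0 < θ) (hq : 1 ≤ q) (hθq : θ * q < 1)
    (hpb : ∀ i, ‖p i‖ * θ ^ i ≤ A * i) (hψb : ∀ j, ‖ψ j‖ ≤ B * θ ^ j)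
    (hXb : ∀ n, ‖X n‖ ≤ M * q ^ n) (hD0 : ∀ n, 0 ≤ D n)
    (hD : Summable fun n : ℕ => ((n : ℝ) + 1) * D n)
    (hv : ∀ n, ‖v n‖ ≤ D n * (M * q ^ (n + 1))) (n : ℕ) :
    ‖X n‖ ≤ A * B / P.a 1 * (∑' m : ℕ, ((m : ℝ) + 1) * D m) * M * q ^ n := by
  have hA : 0 ≤ A := by
    have := (mul_nonneg (norm_nonneg _) (pow_nonneg hθ.le 1)).trans (hpb 1)
    simpa using this
  have hB : 0 ≤ B := by simpa using (norm_nonneg _).trans (hψb 0)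
  have hM : 0 ≤ M := by simpa using (norm_nonneg _).trans (hXb 0)
  have hq0 : 0 < q := zero_lt_one.trans_le hq
  have hθ1 : θ ≤ 1 := by nlinarith
  have ha1 := P.a_pos 1
  have hlow : ∀ m < n, ‖ψ n‖ * (‖p (m + 1)‖ * ‖v m‖) ≤ A * B * M * q ^ n * ((m + 1) * D m) := by
    intro m hm
    obtain ⟨k, rfl⟩ := Nat.exists_eq_add_of_le (Nat.succ_le_of_lt hm)
    have hk : θ ^ k ≤ q ^ k := (pow_le_one₀ hθ.le hθ1).trans (one_le_pow₀ hq)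
    have hpm := hpb (m + 1)
    push_cast at hpm
    have hDm := hD0 m
    calc _ ≤ B * θ ^ (m + 1 + k) * (‖p (m + 1)‖ * (D m * (M * q ^ (m + 1)))) := by
          gcongr
          exacts [hψb _, hv m]
      _ = (‖p (m + 1)‖ * θ ^ (m + 1)) * (B * θ ^ k * (D m * (M * q ^ (m + 1)))) := by ring
      _ ≤ (A * (m + 1)) * (B * q ^ k * (D m * (M * q ^ (m + 1)))) := by gcongr
      _ = _ := by rw [Nat.succ_eq_add_one]; ring
  have hhigh : ∀ m ≥ n, ‖p n‖ * (‖ψ (m + 1)‖ * ‖v m‖) ≤ A * B * M * q ^ n * ((m + 1) * D m) := by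
    intro m hm
    obtain ⟨k, rfl⟩ := Nat.exists_eq_add_of_le hm
    have hk : (θ * q) ^ (k + 1) ≤ 1 := pow_le_one₀ (by positivity) hθq.le
    have hDm := hD0 (n + k)
    calc _ ≤ ‖p n‖ * (B * θ ^ (n + k + 1) * (D (n + k) * (M * q ^ (n + k + 1)))) := by
          gcongr
          exacts [hψb _, hv _]
      _ = (‖p n‖ * θ ^ n) * (B * (θ * q) ^ (k + 1) * (D (n + k) * (M * q ^ n))) := by
          rw [mul_pow]; ring
      _ ≤ (A * n) * (B * 1 * (D (n + k) * (M * q ^ n))) :=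
          mul_le_mul (hpb n) (by gcongr) (by positivity) (by positivity)
      _ ≤ (A * ((n + k : ℕ) + 1)) * (B * 1 * (D (n + k) * (M * q ^ n))) := by
          gcongr
          push_cast
          linarith [(Nat.cast_nonneg k : (0 : ℝ) ≤ k)]
      _ = _ := by ring
  have hfin : ∀ N ≥ n, P.a 1 * ‖X n‖ ≤
      A * B * M * q ^ n * (∑' m : ℕ, ((m : ℝ) + 1) * D m) + ‖p n‖ * ‖P.wronskian ψ X N‖ := by
    intro N hN
    have hrep := congrArg norm (hp.representation hp0 hp1 hψ hψ0 hX hX0 hN)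
    rw [norm_mul, Complex.norm_real, Real.norm_of_nonneg ha1.le, norm_neg] at hrep
    rw [hrep]
    calc _ ≤ ‖ψ n‖ * ∑ m ∈ Finset.Ico 0 n, ‖p (m + 1)‖ * ‖v m‖ +
          ‖p n‖ * (∑ m ∈ Finset.Ico n N, ‖ψ (m + 1)‖ * ‖v m‖ + ‖P.wronskian ψ X N‖) := by
          refine (norm_add_le _ _).trans ?_
          rw [norm_mul, norm_mul]
          gcongr
          · exact norm_sum_le_of_le _ fun m _ => (norm_mul _ _).le
          · refine (norm_sub_le _ _).trans ?_
            gcongr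
            exact norm_sum_le_of_le _ fun m _ => (norm_mul _ _).le
      _ = (∑ m ∈ Finset.Ico 0 n, ‖ψ n‖ * (‖p (m + 1)‖ * ‖v m‖) +
            ∑ m ∈ Finset.Ico n N, ‖p n‖ * (‖ψ (m + 1)‖ * ‖v m‖)) +
            ‖p n‖ * ‖P.wronskian ψ X N‖ := by
          rw [Finset.mul_sum, mul_add, Finset.mul_sum]; ring
      _ ≤ (∑ m ∈ Finset.Ico 0 n, A * B * M * q ^ n * ((m + 1) * D m) +
            ∑ m ∈ Finset.Ico n N, A * B * M * q ^ n * ((m + 1) * D m)) +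
            ‖p n‖ * ‖P.wronskian ψ X N‖ := by
          gcongr ?_ + ?_ + _
          · exact Finset.sum_le_sum fun m hm => hlow m (Finset.mem_Ico.1 hm).2
          · exact Finset.sum_le_sum fun m hm => hhigh m (Finset.mem_Ico.1 hm).1
      _ ≤ _ := by
          rw [Finset.sum_Ico_consecutive _ (Nat.zero_le n) hN, ← Finset.mul_sum]
          gcongr
          exact hD.sum_le_tsum _ fun m _ => mul_nonneg (by positivity) (hD0 m)
  have hlim := ((tendsto_wronskian_zero (P := P) hθ hq hθq hψb hXb).norm.const_mul ‖p n‖).const_add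
    (A * B * M * q ^ n * (∑' m : ℕ, ((m : ℝ) + 1) * D m))
  rw [norm_zero, mul_zero, add_zero] at hlim
  have hle := ge_of_tendsto hlim (Filter.eventually_atTop.2 ⟨n, hfin⟩)
  calc ‖X n‖ ≤ A * B * M * q ^ n * (∑' m : ℕ, ((m : ℝ) + 1) * D m) / P.a 1 := by
        rw [le_div_iff₀ ha1]
        linarith
    _ = _ := by ring

/-- A solution of subcritical growth of a small perturbation of the periodic equation vanishes. -/
theorem Solves.eq_zero (hp : P.Solves z p 0) (hp0 : p 0 = 0) (hp1 : p 1 = 1)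
    (hψ : P.Solves z ψ 0) (hψ0 : ψ 0 = 1) (hX : P.Solves z X v) (hX0 : X 0 = 0)
    (hθ : 0 < θ) (hq : 1 ≤ q) (hθq : θ * q < 1)
    (hpb : ∀ i, ‖p i‖ * θ ^ i ≤ A * i) (hψb : ∀ j, ‖ψ j‖ ≤ B * θ ^ j)
    (hXb : ∀ n, ‖X n‖ ≤ M * q ^ n) (hD0 : ∀ n, 0 ≤ D n)
    (hD : Summable fun n : ℕ => ((n : ℝ) + 1) * D n)
    (hv : ∀ n, ‖v n‖ ≤ D n * max ‖X n‖ ‖X (n + 1)‖)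
    (hsmall : A * B / P.a 1 * (∑' m : ℕ, ((m : ℝ) + 1) * D m) < 1) : X = 0 := by
  set κ := A * B / P.a 1 * (∑' m : ℕ, ((m : ℝ) + 1) * D m) with hκ
  have hκ0 : 0 ≤ κ := by
    have hA : 0 ≤ A := by
      have := (mul_nonneg (norm_nonneg _) (pow_nonneg hθ.le 1)).trans (hpb 1)
      simpa using this
    have hB : 0 ≤ B := by simpa using (norm_nonneg _).trans (hψb 0)
    exact mul_nonneg (div_nonneg (mul_nonneg hA hB) (P.a_pos 1).le)
      (tsum_nonneg fun m => mul_nonneg (by positivity) (hD0 m))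
  -- The a priori bound is fed back into `Solves.norm_le`, gaining one factor `κ` each time.
  have hit : ∀ k n, ‖X n‖ ≤ κ ^ k * M * q ^ n := by
    intro k
    induction k with
    | zero => simpa using hXb
    | succ k ih =>
      intro n
      have hM : 0 ≤ κ ^ k * M := by simpa using (norm_nonneg _).trans (ih 0)
      have := hp.norm_le hp0 hp1 hψ hψ0 hX hX0 hθ hq hθq hpb hψb ih hD0 hD (fun n => by
        refine (hv n).trans (mul_le_mul_of_nonneg_left (max_le ?_ (ih _)) (hD0 n))
        refine (ih n).trans (mul_le_mul_of_nonneg_left ?_ hM)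
        exact pow_le_pow_right₀ hq n.le_succ) n
      refine this.trans_eq ?_
      rw [← hκ]
      ring
  funext n
  have hlim := ((tendsto_pow_atTop_nhds_zero_of_lt_one hκ0 hsmall).mul_const M).mul_const (q ^ n)
  rw [zero_mul, zero_mul] at hlim
  exact norm_le_zero_iff.1 (ge_of_tendsto' hlim fun k => hit k n)

end Green

end PeriodicJacobi

/-! ### Compactness, the gauge and absence of eigenvalues off the bands. -/

namespace JacobiMatrix

theorem act_single_self (J : JacobiMatrix) (m : ℕ) :
    J.act (lp.single (E := fun _ : ℕ => ℂ) 2 (m + 1) (1 : ℂ)) m = J.c m := by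
  cases m with
  | zero => simp [act]
  | succ m =>
    have h : m ≠ m + 1 + 1 := by omega
    simp [act, h]

theorem act_single_of_lt (J : JacobiMatrix) {m j : ℕ} (h : j + 1 < m) :
    J.act (lp.single (E := fun _ : ℕ => ℂ) 2 m (1 : ℂ)) j = 0 := by
  cases j with
  | zero =>
    have h0 : (0 : ℕ) ≠ m := by omega
    have h1 : (1 : ℕ) ≠ m := by omega
    simp [act, h0, h1]
  | succ j =>
    have h0 : j ≠ m := by omega
    have h1 : j + 1 ≠ m := by omega
    have h2 : j + 2 ≠ m := by omega
    simp [act, h0, h1, h2]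

/-- If the difference of two Jacobi matrices is compact, their upper diagonals are asymptotically
equal. -/
theorem tendsto_upper_sub {J K : JacobiMatrix} (h : IsCompactOperator (J.op - K.op)) :
    Filter.Tendsto (fun n => J.c n - K.c n) Filter.atTop (𝓝 0) := by
  refine Filter.tendsto_of_subseq_tendsto fun ns hns => ?_
  set T := J.op - K.op with hT
  let e : ℕ → HSeq := fun m => lp.single (E := fun _ : ℕ => ℂ) 2 m (1 : ℂ)
  have he : ∀ m, ‖e m‖ = 1 := fun m => by simp [e, lp.norm_single]
  obtain ⟨S, hS, hsub⟩ := h.image_closedBall_subset_compact (𝕜₁ := ℂ) (𝕜₂ := ℂ)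
    (f := (T : HSeq →ₗ[ℂ] HSeq)) 1
  obtain ⟨v, -, φ, hφ, hv⟩ := hS.tendsto_subseq (x := fun k => T (e (ns k + 1)))
    fun k => hsub ⟨e (ns k + 1), by simp [he], rfl⟩
  refine ⟨φ, ?_⟩
  have hTe : ∀ m j, T (e m) j = J.act (e m) j - K.act (e m) j := fun m j => rfl
  -- Each fixed row meets only finitely many basis vectors, so a norm limit of the images of basis
  -- vectors running to infinity has zero coordinates. Entry `ns k` of the image of `e (ns k + 1)`
  -- is the difference of the upper diagonals there.
  have hv0 : v = 0 := by
    ext j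
    have h1 : Filter.Tendsto (fun k => T (e (ns (φ k) + 1)) j) Filter.atTop (𝓝 (v j)) := by
      rw [tendsto_iff_norm_sub_tendsto_zero] at hv ⊢
      exact squeeze_zero (fun _ => norm_nonneg _)
        (fun k => lp.norm_apply_le_norm (by norm_num) (T (e (ns (φ k) + 1)) - v) j) hv
    have h2 : Filter.Tendsto (fun k => T (e (ns (φ k) + 1)) j) Filter.atTop (𝓝 0) := by
      refine tendsto_const_nhds.congr' ?_
      filter_upwards [(hns.comp hφ.tendsto_atTop).eventually_gt_atTop j] with k hk
      have hk' : j + 1 < ns (φ k) + 1 := Nat.succ_lt_succ hk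
      rw [hTe, act_single_of_lt J hk', act_single_of_lt K hk', sub_zero]
    exact tendsto_nhds_unique h1 h2
  rw [hv0, tendsto_zero_iff_norm_tendsto_zero] at hv
  refine squeeze_zero_norm (fun k => ?_) hv
  have := lp.norm_apply_le_norm (by norm_num) (T (e (ns (φ k) + 1))) (ns (φ k))
  rwa [hTe, act_single_self, act_single_self] at this

end JacobiMatrix

/-- The constant only has to absorb the finitely many initial factors; afterwards each factor costs
at most `q`. -/
theorem exists_prod_le_mul_pow {r : ℕ → ℝ} (h0 : ∀ n, 0 ≤ r n) {q : ℝ} (hq : 0 < q)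
    (h : ∀ᶠ n in Filter.atTop, r n ≤ q) :
    ∃ M, ∀ n, ∏ k ∈ Finset.range n, r k ≤ M * q ^ n := by
  obtain ⟨N, hN⟩ := Filter.eventually_atTop.1 h
  have hp : ∀ n, 0 ≤ ∏ k ∈ Finset.range n, r k := fun n => Finset.prod_nonneg fun k _ => h0 k
  set M := ∑ i ∈ Finset.range (N + 1), (∏ k ∈ Finset.range i, r k) / q ^ i with hM
  have hlow : ∀ n ≤ N, ∏ k ∈ Finset.range n, r k ≤ M * q ^ n := fun n hn => by
    rw [← div_le_iff₀ (by positivity)]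
    exact Finset.single_le_sum (f := fun i => (∏ k ∈ Finset.range i, r k) / q ^ i)
      (fun i _ => div_nonneg (hp i) (by positivity)) (Finset.mem_range.2 (by omega))
  refine ⟨M, fun n => ?_⟩
  obtain hn | hn := le_total n N
  · exact hlow n hn
  · induction n, hn using Nat.le_induction with
    | base => exact hlow N le_rfl
    | succ n hn ih =>
      rw [Finset.prod_range_succ, pow_succ, ← mul_assoc]
      exact mul_le_mul ih (hN n hn) (h0 n) ((hp n).trans ih)

namespace PeriodicJacobi

variable {P : PeriodicJacobi} {J : JacobiMatrix}

theorem perturbation_nonneg (n : ℕ) : 0 ≤ P.perturbation J n := by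
  cases n <;> simp only [perturbation] <;> positivity

/-- The diagonal transformation which turns the upper diagonal of `J` into that of `P`. -/
noncomputable def gauge (P : PeriodicJacobi) (J : JacobiMatrix) (n : ℕ) : ℂ :=
  ∏ k ∈ Finset.range n, J.c k / P.a k

theorem gauge_ne_zero (n : ℕ) : P.gauge J n ≠ 0 :=
  Finset.prod_ne_zero_iff.2 fun k _ =>
    div_ne_zero (J.c_ne_zero k) (by exact_mod_cast (P.a_pos k).ne')

theorem mul_gauge_succ (n : ℕ) : (P.a n : ℂ) * P.gauge J (n + 1) = P.gauge J n * J.c n := by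
  have : (P.a n : ℂ) ≠ 0 := by exact_mod_cast (P.a_pos n).ne'
  rw [gauge, Finset.prod_range_succ, ← gauge]
  field_simp

/-- An eigensequence of `J`, transformed, solves a perturbed periodic equation. -/
theorem exists_solves {z : ℂ} {u : ℕ → ℂ} (hu : ∀ n, J.act u n = z * u n) :
    ∃ v, P.Solves z (shiftDown fun n => P.gauge J n * u n) v ∧
      ∀ n, ‖v n‖ ≤ P.perturbation J n *
        max ‖shiftDown (fun n => P.gauge J n * u n) n‖
          ‖shiftDown (fun n => P.gauge J n * u n) (n + 1)‖ := by
  -- The right-hand side `v` is defined to be the left-hand side of the equation; all the content is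
  -- in its bound.
  refine ⟨fun n => _, fun n => rfl, fun n => ?_⟩
  cases n with
  | zero =>
    have e : (P.a (0 + 1) : ℂ) * shiftDown (fun n => P.gauge J n * u n) 0 +
        ((P.b 0 : ℂ) - z) * shiftDown (fun n => P.gauge J n * u n) (0 + 1) +
        (P.a 0 : ℂ) * shiftDown (fun n => P.gauge J n * u n) (0 + 2) =
        ((P.b 0 : ℂ) - J.b 0) * shiftDown (fun n => P.gauge J n * u n) (0 + 1) := by
      have h := hu 0
      have g := P.mul_gauge_succ (J := J) 0
      simp only [JacobiMatrix.act, shiftDown, zero_add] at h g ⊢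
      linear_combination P.gauge J 0 * h + u 1 * g
    refine (congrArg norm e).trans_le ?_
    rw [norm_mul]
    exact mul_le_mul_of_nonneg_left (le_max_right _ _) (norm_nonneg _)
  | succ n =>
    have e : (P.a (n + 1 + 1) : ℂ) * shiftDown (fun n => P.gauge J n * u n) (n + 1) +
        ((P.b (n + 1) : ℂ) - z) * shiftDown (fun n => P.gauge J n * u n) (n + 1 + 1) +
        (P.a (n + 1) : ℂ) * shiftDown (fun n => P.gauge J n * u n) (n + 1 + 2) =
        ((P.b (n + 1) : ℂ) - J.b (n + 1)) * shiftDown (fun n => P.gauge J n * u n) (n + 1 + 1) +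
        ((P.a n : ℂ) - J.a n * J.c n / P.a n) *
          shiftDown (fun n => P.gauge J n * u n) (n + 1) := by
      have h := hu (n + 1)
      have g := P.mul_gauge_succ (J := J) (n + 1)
      have g' := P.mul_gauge_succ (J := J) n
      have ha : (P.a n : ℂ) ≠ 0 := by exact_mod_cast (P.a_pos n).ne'
      rw [show n + 1 + 1 = n + 2 from rfl, P.a_periodic]
      have g'' : P.gauge J (n + 1) = P.gauge J n * J.c n / P.a n := by
        rw [eq_div_iff ha, ← g']; ring
      simp only [JacobiMatrix.act, shiftDown, show n + 1 + 1 = n + 2 from rfl] at h g ⊢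
      linear_combination P.gauge J (n + 1) * h + u (n + 2) * g - J.a n * u n * g''
    refine (congrArg norm e).trans_le ?_
    refine (norm_add_le _ _).trans ?_
    rw [norm_mul, norm_mul, perturbation, add_mul]
    gcongr
    · exact le_max_right _ _
    · exact le_max_left _ _

theorem exists_gauge_le (hc : Filter.Tendsto (fun n => J.c n - P.a n) Filter.atTop (𝓝 0))
    {q : ℝ} (hq : 1 < q) : ∃ M, ∀ n, ‖P.gauge J n‖ ≤ M * q ^ n := by
  have hmin : ∀ n, min (P.a 0) (P.a 1) ≤ P.a n := fun n => by
    obtain ⟨k, rfl | rfl⟩ := Nat.even_or_odd' n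
    · rw [a_even]; exact min_le_left _ _
    · rw [a_odd]; exact min_le_right _ _
  have hpos : 0 < min (P.a 0) (P.a 1) := lt_min (P.a_pos 0) (P.a_pos 1)
  obtain ⟨M, hM⟩ := exists_prod_le_mul_pow (r := fun n => ‖J.c n / P.a n‖)
    (fun n => norm_nonneg _) (zero_lt_one.trans hq) (by
      have h0 : (0 : ℝ) < (q - 1) * min (P.a 0) (P.a 1) := mul_pos (by linarith) hpos
      filter_upwards [(tendsto_zero_iff_norm_tendsto_zero.1 hc).eventually_lt_const h0] with n hn
      have han := P.a_pos n
      rw [norm_div, Complex.norm_real, Real.norm_of_nonneg han.le, div_le_iff₀ han]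
      have h1 : ‖J.c n‖ ≤ ‖J.c n - P.a n‖ + P.a n := by
        have := norm_add_le (J.c n - P.a n) (P.a n : ℂ)
        rwa [sub_add_cancel, Complex.norm_real, Real.norm_of_nonneg han.le] at this
      have h2 : (q - 1) * min (P.a 0) (P.a 1) ≤ (q - 1) * P.a n :=
        mul_le_mul_of_nonneg_left (hmin n) (by linarith)
      linarith)
  exact ⟨M, fun n => by rw [gauge, norm_prod]; exact hM n⟩

theorem not_hasEigenvalue (hc : Filter.Tendsto (fun n => J.c n - P.a n) Filter.atTop (𝓝 0))
    {z ω : ℂ} {d : ℝ} (hz : P.IsCharRoot z (ω ^ 2)) (hω : ‖ω‖ < 1) (hd : 0 ≤ d)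
    (hb : P.b 1 = -P.b 0) (hd2 : d ^ 2 = P.b 0 ^ 2 + (P.a 0 + P.a 1) ^ 2)
    (hlt : P.a 1 < P.a 0)
    (hmoment : Summable fun n : ℕ => ((n : ℝ) + 1) * P.perturbation J n)
    (hsmall : d / P.a 0 * (2 * d / (P.a 0 - P.a 1)) / P.a 1 *
      ∑' n : ℕ, ((n : ℝ) + 1) * P.perturbation J n < 1) :
    ¬ Module.End.HasEigenvalue (J.op : HSeq →ₗ[ℂ] HSeq) z := by
  intro hev
  obtain ⟨u, hu⟩ := hev.exists_hasEigenvector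
  have hrow : ∀ n, J.act u n = z * u n := fun n => by
    have := congrArg (fun y : HSeq => y n) hu.apply_eq_smul
    exact this
  have p0 := P.a_pos 0
  have p1 := P.a_pos 1
  have hω0 : 0 < ‖ω‖ := norm_pos_iff.2 (by rintro rfl; exact hz.ne_zero (by simp))
  have hbd : |P.b 0| ≤ d := abs_le_of_sq_le_sq (by nlinarith) hd
  have had : P.a 0 ≤ d := abs_le_of_sq_le_sq' (by nlinarith) hd |>.2
  have hzω := hz.norm_mul_le hω.le hd hb hd2
  -- `1 < q` pays for the growth of the gauge, and `q < ‖ω‖⁻¹` lets the decay of the Floquet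
  -- solution win.
  obtain ⟨q, hq1, hq2⟩ := exists_between ((one_lt_inv₀ hω0).2 hω)
  have hωq : ‖ω‖ * q < 1 := by
    calc ‖ω‖ * q < ‖ω‖ * ‖ω‖⁻¹ := by gcongr
      _ = 1 := mul_inv_cancel₀ hω0.ne'
  obtain ⟨M, hM⟩ := exists_gauge_le hc hq1
  have hq0 : 0 < q := by linarith
  have hM0 : 0 ≤ M := by simpa using (norm_nonneg _).trans (hM 0)
  obtain ⟨v, hX, hv⟩ := P.exists_solves hrow
  have hXb : ∀ n, ‖shiftDown (fun n => P.gauge J n * u n) n‖ ≤ M * ‖u‖ * q ^ n := by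
    intro n
    cases n with
    | zero => simp only [shiftDown, norm_zero]; positivity
    | succ n =>
      simp only [shiftDown, norm_mul]
      calc _ ≤ (M * q ^ n) * ‖u‖ := by
            gcongr
            exacts [hM n, lp.norm_apply_le_norm (by norm_num) u n]
        _ ≤ (M * q ^ (n + 1)) * ‖u‖ := by
            gcongr
            exacts [hq1.le, n.le_succ]
        _ = _ := by ring
  have hne : (P.a 0 + P.a 1 * ω ^ 2 : ℂ) ≠ 0 := by
    have h1 : ‖ω ^ 2‖ ≤ 1 := by rw [norm_pow]; exact pow_le_one₀ hω0.le hω.le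
    have := P.norm_add_mul_ge h1
    exact norm_pos_iff.1 ((sub_pos.2 hlt).trans_le this)
  have hzero := Solves.eq_zero hz.solves_regularSolution (regularSolution_zero z _)
    (regularSolution_one z _) (hz.solves_floquetSolution hne) (floquetSolution_zero z _) hX rfl
    hω0 hq1.le hωq (norm_regularSolution_mul_le hz hω.le hzω hbd had hlt)
    (norm_floquetSolution_le hω.le hzω (by rwa [hb, abs_neg]) had hlt) hXb
    perturbation_nonneg hmoment hv hsmall
  refine hu.2 (lp.ext (funext fun n => ?_))
  have := congrFun hzero (n + 1)
  exact (mul_eq_zero.1 this).resolve_left (gauge_ne_zero n)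

end PeriodicJacobi

/-! ### Spectral stability and the bands of the periodic matrix. -/

theorem bijective_of_notMem_spectrum {T : HSeq →L[ℂ] HSeq} {z : ℂ} (h : z ∉ spectrum ℂ T) :
    Function.Bijective (T - z • (1 : HSeq →L[ℂ] HSeq)) := by
  have hu : IsUnit (algebraMap ℂ (HSeq →L[ℂ] HSeq) z - T) := by
    simpa [spectrum.mem_iff] using h
  rw [← ContinuousLinearMap.isUnit_iff_bijective]
  have := hu.neg
  rwa [neg_sub, Algebra.algebraMap_eq_smul_one] at this

theorem not_bounded_below_of_mem_continuousSpectrum {T : HSeq →L[ℂ] HSeq} {z : ℂ}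
    (h : z ∈ continuousSpectrum T) {ε : ℝ} (hε : 0 < ε) :
    ¬ ∀ y, ε * ‖y‖ ≤ ‖(T - z • (1 : HSeq →L[ℂ] HSeq)) y‖ := by
  intro hb
  obtain ⟨-, hd, hs⟩ := h
  have hanti : AntilipschitzWith (Real.toNNReal ε⁻¹) (T - z • (1 : HSeq →L[ℂ] HSeq)) := by
    refine ContinuousLinearMap.antilipschitz_of_bound _ fun y => ?_
    rw [Real.coe_toNNReal _ (by positivity), ← div_eq_inv_mul, le_div_iff₀ hε, mul_comm]
    exact hb y
  have hc := hanti.isClosed_range (T - z • (1 : HSeq →L[ℂ] HSeq)).uniformContinuous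
  refine hs (Set.range_eq_univ.1 ?_)
  rw [← hc.closure_eq]
  exact hd.closure_range

/-- The continuous spectrum is stable under compact perturbations, as a part of the spectrum. -/
theorem mem_spectrum_of_mem_continuousSpectrum {S T : HSeq →L[ℂ] HSeq}
    (hc : IsCompactOperator (S - T)) {z : ℂ} (hz : z ∈ continuousSpectrum T) :
    z ∈ spectrum ℂ S := by
  by_contra h
  obtain ⟨hinj, -, hsurj⟩ := hz
  have hu := ContinuousLinearMap.isUnit_iff_bijective.2 (bijective_of_notMem_spectrum h)
  obtain ⟨U, hU⟩ := hu
  set R : HSeq →L[ℂ] HSeq := ↑U⁻¹ with hR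
  have hRU : R * U = 1 := U.inv_mul
  have hUR : (U : HSeq →L[ℂ] HSeq) * R = 1 := U.mul_inv
  have hC : IsCompactOperator (R * (S - T)) := hc.clm_comp R
  -- With `U = S - z` and `R` its inverse, the Fredholm alternative for `R * (S - T)` at `1` makes
  -- `T - z` either non-injective or invertible. Both contradict membership in the continuous
  -- spectrum.
  have hfac : T - z • (1 : HSeq →L[ℂ] HSeq) = U * (1 - R * (S - T)) := by
    rw [mul_sub, ← mul_assoc, hUR, hU]
    simp only [mul_one, one_mul]
    abel
  rcases hC.hasEigenvalue_or_mem_resolventSet (μ := (1 : ℂ)) one_ne_zero with he | hr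
  · obtain ⟨y, hy⟩ := he.exists_hasEigenvector
    have hy1 : (R * (S - T)) y = y := by
      have := hy.apply_eq_smul
      rwa [one_smul] at this
    refine hy.2 (hinj ?_)
    rw [map_zero, hfac, mul_apply_eq_comp, sub_apply, hy1]
    simp
  · have h1 : IsUnit (1 - R * (S - T)) := by
      have : IsUnit (algebraMap ℂ (HSeq →L[ℂ] HSeq) 1 - R * (S - T)) := hr
      rwa [map_one] at this
    have h2 : IsUnit (T - z • (1 : HSeq →L[ℂ] HSeq)) := by
      rw [hfac]
      exact U.isUnit.mul h1
    exact hsurj (ContinuousLinearMap.isUnit_iff_bijective.1 h2).2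

theorem exists_hSeq_of_hasSum {f : ℕ → ℂ} {S : ℝ} (h : HasSum (fun n => ‖f n‖ ^ 2) S) :
    ∃ x : HSeq, ⇑x = f ∧ ‖x‖ ^ 2 = S := by
  have hm : Memℓp (E := fun _ : ℕ => ℂ) f 2 := by
    refine memℓp_gen ?_
    simpa using h.summable
  exact ⟨⟨f, hm⟩, rfl, (JacobiMatrix.hasSum_normSq ⟨f, hm⟩).unique h⟩

theorem HSeq.tendsto_zero (y : HSeq) : Filter.Tendsto (fun n => y n) Filter.atTop (𝓝 0) := by
  have h := (JacobiMatrix.hasSum_normSq y).summable.tendsto_atTop_zero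
  rw [tendsto_zero_iff_norm_tendsto_zero]
  have h2 := h.sqrt
  simpa [Real.sqrt_sq] using h2

/-- An elliptic or parabolic three-term recurrence has no nonzero solution tending to zero. -/
theorem eq_zero_of_recurrence {u : ℕ → ℂ} {τ : ℝ} (hτ : |τ| ≤ 2)
    (hu : ∀ k, u (k + 2) = τ * u (k + 1) - u k)
    (h0 : Filter.Tendsto u Filter.atTop (𝓝 0)) : u 0 = 0 := by
  -- This quadratic form is conserved by the recurrence, so it vanishes for a solution tending to
  -- zero.
  set E : ℕ → ℂ := fun k => u (k + 1) ^ 2 - τ * u k * u (k + 1) + u k ^ 2 with hE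
  have hconst : ∀ k, E k = E 0 := by
    intro k
    induction k with
    | zero => rfl
    | succ k ih =>
      rw [← ih]
      simp only [hE]
      linear_combination (u (k + 2) - u k) * hu k
  have h1 : Filter.Tendsto (fun k => u (k + 1)) Filter.atTop (𝓝 0) :=
    h0.comp (Filter.tendsto_add_atTop_nat 1)
  have hlim : Filter.Tendsto E Filter.atTop (𝓝 0) := by
    have := ((h1.pow 2).sub ((h0.const_mul (τ : ℂ)).mul h1)).add (h0.pow 2)
    simpa using this
  have hE0 : ∀ k, E k = 0 := by
    have : E 0 = 0 := tendsto_nhds_unique (tendsto_const_nhds.congr fun k => (hconst k).symm) hlim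
    intro k
    rw [hconst, this]
  obtain ⟨h2, h2'⟩ := abs_le.1 hτ
  set β := √(1 - τ ^ 2 / 4) with hβ
  have hβ2 : β ^ 2 = 1 - τ ^ 2 / 4 := Real.sq_sqrt (by nlinarith)
  have hβc : (β : ℂ) ^ 2 = 1 - τ ^ 2 / 4 := by exact_mod_cast hβ2
  have hunit : ∀ ε : ℝ, ε ^ 2 = 1 → ‖((τ / 2 : ℝ) : ℂ) + (ε * β : ℝ) * Complex.I‖ = 1 := by
    intro ε hε
    rw [Complex.norm_add_mul_I, Real.sqrt_eq_one]
    rw [mul_pow, hε, hβ2]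
    ring
  have hstep : ∀ k, ‖u (k + 1)‖ = ‖u k‖ := by
    intro k
    have hk := hE0 k
    simp only [hE] at hk
    -- The form splits over the characteristic roots, which have modulus `1` because `|τ| ≤ 2`;
    -- hence `‖u k‖` is constant, also when the roots coincide.
    have hprod : (u (k + 1) - (((τ / 2 : ℝ) : ℂ) + (1 * β : ℝ) * Complex.I) * u k) *
        (u (k + 1) - (((τ / 2 : ℝ) : ℂ) + (-1 * β : ℝ) * Complex.I) * u k) = 0 := by
      push_cast
      linear_combination hk + u k ^ 2 * hβc - β ^ 2 * u k ^ 2 * Complex.I_sq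
    rcases mul_eq_zero.1 hprod with h | h
    · rw [sub_eq_zero.1 h, norm_mul, hunit 1 (by norm_num), one_mul]
    · rw [sub_eq_zero.1 h, norm_mul, hunit (-1) (by norm_num), one_mul]
  have hnorm : ∀ k, ‖u k‖ = ‖u 0‖ := by
    intro k
    induction k with
    | zero => rfl
    | succ k ih => rw [hstep, ih]
  have := tendsto_nhds_unique (tendsto_const_nhds.congr fun k => (hnorm k).symm) h0.norm
  simpa using this

namespace PeriodicJacobi

variable {P : PeriodicJacobi}

/-- The two-band polynomial condition describes points of the spectrum. -/
theorem mem_spectrum_of_abs_le {x : ℝ}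
    (hx : |(x - P.b 0) * (x - P.b 1) - P.a 0 ^ 2 - P.a 1 ^ 2| ≤ 2 * (P.a 0 * P.a 1)) :
    (x : ℂ) ∈ spectrum ℂ P.op := by
  by_contra h
  -- Solving for the first basis vector gives a `y` that is homogeneous from the second row on. It
  -- must vanish, which contradicts the first row.
  obtain ⟨y, hy⟩ := (bijective_of_notMem_spectrum h).2 (lp.single (E := fun _ : ℕ => ℂ) 2 0 1)
  have hrow : ∀ n, P.toJacobi.act y n - x * y n = lp.single (E := fun _ : ℕ => ℂ) 2 0 1 n :=
    fun n => congrArg (fun y : HSeq => y n) hy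
  have hsucc : ∀ n, (P.a n : ℂ) * y n + P.b (n + 1) * y (n + 1) + P.a (n + 1) * y (n + 2) -
      x * y (n + 1) = 0 := fun n => by
    have := hrow (n + 1)
    rwa [lp.single_apply_ne _ _ _ (Nat.succ_ne_zero n)] at this
  have p0 := P.a_pos 0
  have p1 := P.a_pos 1
  set τ : ℝ := ((x - P.b 0) * (x - P.b 1) - P.a 0 ^ 2 - P.a 1 ^ 2) / (P.a 0 * P.a 1) with hτ
  have hpq : 0 < P.a 0 * P.a 1 := mul_pos p0 p1
  have hτ2 : |τ| ≤ 2 := by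
    rw [hτ, abs_div, abs_of_pos hpq, div_le_iff₀ hpq]
    exact hx
  have hτm : (τ : ℂ) * (P.a 0 * P.a 1) =
      (x - P.b 0) * (x - P.b 1) - P.a 0 ^ 2 - P.a 1 ^ 2 := by
    have : τ * (P.a 0 * P.a 1) = (x - P.b 0) * (x - P.b 1) - P.a 0 ^ 2 - P.a 1 ^ 2 :=
      div_mul_cancel₀ _ hpq.ne'
    exact_mod_cast this
  have hpqc : (P.a 0 * P.a 1 : ℂ) ≠ 0 := by exact_mod_cast hpq.ne'
  have hrec : ∀ j, y (j + 4) = τ * y (j + 2) - y j := by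
    intro j
    have r1 := hsucc j
    have r2 := hsucc (j + 1)
    have r3 := hsucc (j + 2)
    simp only [show j + 1 + 1 = j + 2 from rfl, show j + 1 + 2 = j + 3 from rfl,
      show j + 2 + 2 = j + 4 from rfl] at r1 r2 r3
    rw [P.a_periodic, P.b_periodic] at r2
    rw [P.a_periodic, show j + 3 = j + 1 + 2 from rfl, P.a_periodic, P.b_periodic] at r3
    -- Three consecutive rows are combined so that `y (j + 1)` and `y (j + 3)` drop out.
    have key : (P.a j * P.a (j + 1) : ℂ) * (y (j + 4) + y j) =
        ((x - P.b j) * (x - P.b (j + 1)) - P.a j ^ 2 - P.a (j + 1) ^ 2) * y (j + 2) := by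
      linear_combination P.a (j + 1) * r1 - (P.b (j + 1) - x) * r2 + P.a j * r3
    have key' : (P.a 0 * P.a 1 : ℂ) * (y (j + 4) + y j) =
        ((x - P.b 0) * (x - P.b 1) - P.a 0 ^ 2 - P.a 1 ^ 2) * y (j + 2) := by
      obtain ⟨k, rfl | rfl⟩ := Nat.even_or_odd' j
      · rw [a_even, a_odd, b_even, b_odd] at key
        exact key
      · rw [show 2 * k + 1 + 1 = 2 * (k + 1) by ring, a_even, a_odd, b_even, b_odd] at key
        linear_combination key
    refine mul_left_cancel₀ hpqc ?_
    linear_combination key' - y (j + 2) * hτm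
  have hzero : ∀ j, y j = 0 := fun j => by
    have hlim : Filter.Tendsto (fun k => y (j + 2 * k)) Filter.atTop (𝓝 0) :=
      (HSeq.tendsto_zero y).comp (Filter.tendsto_atTop_mono (fun k => by
        show k ≤ j + 2 * k
        omega) Filter.tendsto_id)
    exact eq_zero_of_recurrence hτ2 (fun k => hrec (j + 2 * k)) hlim
  have h0 := hrow 0
  rw [lp.single_apply_self] at h0
  simp [JacobiMatrix.act, hzero] at h0

/-- If `P.a 0 < P.a 1`, there is an edge state at `P.b 0`: the sequence vanishing at odd indices and
geometric with ratio `-P.a 0 / P.a 1` at even ones. This eigenvector contradicts purely continuous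
spectrum. -/
theorem a_one_le_a_zero (hpure : spectrum ℂ P.op = continuousSpectrum P.op) :
    P.a 1 ≤ P.a 0 := by
  by_contra! hlt
  have p0 := P.a_pos 0
  have p1 := P.a_pos 1
  set κ : ℝ := P.a 0 / P.a 1 with hκ
  have hκ0 : 0 ≤ κ := (div_pos p0 p1).le
  have hκ1 : κ < 1 := (div_lt_one p1).2 hlt
  have hsum : HasSum (fun n => ‖interleave (fun k => (-κ : ℂ) ^ k) 0 n‖ ^ 2)
      ((1 - κ ^ 2)⁻¹ + 0) := by
    refine HasSum.even_add_odd ?_ ?_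
    · have : ∀ k : ℕ, ‖interleave (fun k => (-κ : ℂ) ^ k) 0 (2 * k)‖ ^ 2 = (κ ^ 2) ^ k := fun k => by
        simp only [interleave_even, norm_pow, norm_neg, Complex.norm_real,
          Real.norm_of_nonneg hκ0]
        ring
      simp only [this]
      exact hasSum_geometric_of_lt_one (by positivity) (by nlinarith)
    · simp
  obtain ⟨y, hy, -⟩ := exists_hSeq_of_hasSum hsum
  have hy0 : y 0 = 1 := by rw [hy]; simp [interleave]
  have he : ∀ k, y (2 * k) = (-κ) ^ k := fun k => by rw [hy]; simp
  have ho : ∀ k, y (2 * k + 1) = 0 := fun k => by rw [hy]; simp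
  have hκc : (κ : ℂ) * P.a 1 = P.a 0 := by
    have : κ * P.a 1 = P.a 0 := div_mul_cancel₀ _ p1.ne'
    exact_mod_cast this
  have hker : (P.op - (P.b 0 : ℂ) • (1 : HSeq →L[ℂ] HSeq)) y = 0 := by
    refine lp.ext (funext fun n => ?_)
    change P.toJacobi.act y n - P.b 0 * y n = 0
    cases n with
    | zero =>
      have := ho 0
      simp only [mul_zero, zero_add] at this
      simp [JacobiMatrix.act, toJacobi, this]
    | succ n =>
      change (P.a n : ℂ) * y n + P.b (n + 1) * y (n + 1) + P.a (n + 1) * y (n + 2) -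
        P.b 0 * y (n + 1) = 0
      obtain ⟨k, rfl | rfl⟩ := Nat.even_or_odd' n
      · rw [show 2 * k + 2 = 2 * (k + 1) by ring, a_even, a_odd, he, ho, he]
        linear_combination -(-κ : ℂ) ^ k * hκc
      · rw [show 2 * k + 1 + 2 = 2 * (k + 1) + 1 by ring, ho, ho,
          show 2 * k + 1 + 1 = 2 * (k + 1) by ring, b_even]
        ring
  have hninj : ¬ Function.Injective (P.op - (P.b 0 : ℂ) • (1 : HSeq →L[ℂ] HSeq)) := fun hinj => by
    have : y = 0 := hinj (by rw [hker, map_zero])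
    rw [this] at hy0
    simp at hy0
  have hmem : (P.b 0 : ℂ) ∈ spectrum ℂ P.op := by
    by_contra h
    exact hninj (bijective_of_notMem_spectrum h).1
  rw [hpure] at hmem
  exact hninj hmem.1

end PeriodicJacobi

namespace PeriodicJacobi

/-- The periodic matrix with the diagonal deleted. -/
def offDiagonal (P : PeriodicJacobi) : PeriodicJacobi where
  a := P.a
  b := 0
  a_pos := P.a_pos
  a_periodic := P.a_periodic
  b_periodic _ := rfl

variable {P : PeriodicJacobi}

theorem op_eq_row (P : PeriodicJacobi) (y : HSeq) (n : ℕ) :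
    P.op y n = P.a (n + 1) * shiftDown y n + P.b n * y n + P.a n * y (n + 1) := by
  change P.toJacobi.act y n = _
  cases n with
  | zero => simp [JacobiMatrix.act, toJacobi, shiftDown]
  | succ n => rw [show n + 1 + 1 = n + 2 from rfl, P.a_periodic]; rfl

/-- The off-diagonal part is a combination of a unitary and a contraction, which interchange
neighbouring entries. -/
theorem exists_offDiagonal_eq (y : HSeq) :
    ∃ x x' : HSeq, ‖x‖ = ‖y‖ ∧ ‖x'‖ ≤ ‖y‖ ∧
      P.offDiagonal.op y = (P.a 0 : ℂ) • x + (P.a 1 : ℂ) • x' := by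
  have hy := JacobiMatrix.hasSum_normSq y
  obtain ⟨E, hE⟩ : ∃ E, HasSum (fun k => ‖y (2 * k)‖ ^ 2) E :=
    hy.summable.comp_injective (i := fun k => 2 * k) fun i j h => by simpa using h
  obtain ⟨O, hO⟩ : ∃ O, HasSum (fun k => ‖y (2 * k + 1)‖ ^ 2) O :=
    hy.summable.comp_injective (i := fun k => 2 * k + 1) fun i j h => by simpa using h
  have hEO := (HasSum.even_add_odd (f := fun n => ‖y n‖ ^ 2) hE hO).unique hy
  obtain ⟨x, hx, hxn⟩ := exists_hSeq_of_hasSum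
    (f := interleave (fun k => y (2 * k + 1)) fun k => y (2 * k)) (S := O + E)
    (HasSum.even_add_odd (by simpa using hO) (by simpa using hE))
  have hO' : HasSum (fun k => ‖interleave (shiftDown fun k => y (2 * k + 1))
      (fun k => y (2 * k + 2)) (2 * k)‖ ^ 2) O := by
    rw [← hasSum_nat_add_iff' 1]
    simpa [shiftDown] using hO
  have hE' : HasSum (fun k => ‖interleave (shiftDown fun k => y (2 * k + 1))
      (fun k => y (2 * k + 2)) (2 * k + 1)‖ ^ 2) (E - ‖y 0‖ ^ 2) := by
    have := (hasSum_nat_add_iff' 1).2 hE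
    simpa [mul_add] using this
  -- `x` swaps the entries `2 * k` and `2 * k + 1`, while `x'` swaps `2 * k + 1` and `2 * k + 2` and
  -- loses the entry `y 0`, whence only a contraction.
  obtain ⟨x', hx', hxn'⟩ := exists_hSeq_of_hasSum (HasSum.even_add_odd hO' hE')
  refine ⟨x, x', ?_, ?_, ?_⟩
  · rw [← sq_eq_sq₀ (norm_nonneg _) (norm_nonneg _), hxn, ← hEO, add_comm]
  · rw [← sq_le_sq₀ (norm_nonneg _) (norm_nonneg _), hxn', ← hEO]
    nlinarith [sq_nonneg ‖y 0‖]
  · refine lp.ext (funext fun n => ?_)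
    rw [op_eq_row]
    change _ = (P.a 0 : ℂ) * x n + P.a 1 * x' n
    rw [hx, hx']
    change (P.a (n + 1) : ℂ) * shiftDown y n + ((0 : ℝ) : ℂ) * y n + P.a n * y (n + 1) = _
    obtain ⟨k, rfl | rfl⟩ := Nat.even_or_odd' n
    · rw [a_odd, a_even, interleave_even, interleave_even]
      cases k with
      | zero => simp [shiftDown]
      | succ k =>
        rw [show 2 * (k + 1) = 2 * k + 1 + 1 by ring]
        simp only [shiftDown]
        push_cast
        ring
    · rw [show 2 * k + 1 + 1 = 2 * (k + 1) by ring, a_even, a_odd, interleave_odd, interleave_odd]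
      simp only [shiftDown, mul_add, mul_one]
      push_cast
      ring

theorem norm_offDiagonal_le (y : HSeq) : ‖P.offDiagonal.op y‖ ≤ (P.a 0 + P.a 1) * ‖y‖ := by
  obtain ⟨x, x', hx, hx', h⟩ := P.exists_offDiagonal_eq y
  have p0 := P.a_pos 0
  have p1 := P.a_pos 1
  rw [h]
  refine (norm_add_le _ _).trans ?_
  rw [norm_smul, norm_smul, Complex.norm_real, Complex.norm_real, Real.norm_of_nonneg p0.le,
    Real.norm_of_nonneg p1.le, hx, add_mul]
  gcongr

theorem le_norm_offDiagonal (y : HSeq) : (P.a 0 - P.a 1) * ‖y‖ ≤ ‖P.offDiagonal.op y‖ := by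
  obtain ⟨x, x', hx, hx', h⟩ := P.exists_offDiagonal_eq y
  have p0 := P.a_pos 0
  have p1 := P.a_pos 1
  rw [h]
  have := norm_sub_le_norm_add ((P.a 0 : ℂ) • x) ((P.a 1 : ℂ) • x')
  rw [norm_smul, norm_smul, Complex.norm_real, Complex.norm_real, Real.norm_of_nonneg p0.le,
    Real.norm_of_nonneg p1.le, hx] at this
  nlinarith

/-- The mean of the diagonal entries. -/
noncomputable def center (P : PeriodicJacobi) : ℝ := (P.b 0 + P.b 1) / 2

/-- Half the difference of the diagonal entries. -/
noncomputable def halfDiff (P : PeriodicJacobi) : ℝ := (P.b 0 - P.b 1) / 2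

theorem b_sub_center (n : ℕ) : P.b n - P.center = (-1) ^ n * P.halfDiff := by
  obtain ⟨k, rfl | rfl⟩ := Nat.even_or_odd' n
  · rw [b_even, pow_mul, center, halfDiff]; norm_num; ring
  · rw [b_odd, pow_succ, pow_mul, center, halfDiff]; norm_num; ring

/-- The centred diagonal is `halfDiff` times the alternating sign, which anticommutes with the
off-diagonal part, so the cross terms cancel in the sum. In coordinates they telescope through `s`.
-/
theorem normSq_op_sub_center (y : HSeq) :
    ‖(P.op - (P.center : ℂ) • (1 : HSeq →L[ℂ] HSeq)) y‖ ^ 2 =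
      P.halfDiff ^ 2 * ‖y‖ ^ 2 + ‖P.offDiagonal.op y‖ ^ 2 := by
  set Y := shiftDown y with hY
  set T := P.op - (P.center : ℂ) • (1 : HSeq →L[ℂ] HSeq) with hT
  set s : ℕ → ℝ := fun n => -((-1) ^ n * (P.a (n + 1) * (star (Y n) * Y (n + 1)).re)) with hs
  have hrow : ∀ n, ‖T y n‖ ^ 2 = P.halfDiff ^ 2 * ‖y n‖ ^ 2 + ‖P.offDiagonal.op y n‖ ^ 2 +
      2 * P.halfDiff * (s (n + 1) - s n) := by
    intro n
    have h0 : P.offDiagonal.op y n = P.a (n + 1) * Y n + P.a n * y (n + 1) := by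
      rw [op_eq_row]
      change (P.a (n + 1) : ℂ) * shiftDown y n + ((0 : ℝ) : ℂ) * y n + P.a n * y (n + 1) = _
      simp [hY]
    have h1 : T y n = ((-1) ^ n * P.halfDiff : ℝ) * y n + P.offDiagonal.op y n := by
      rw [h0, ← b_sub_center]
      change P.op y n - P.center * y n = _
      rw [op_eq_row]
      push_cast
      ring
    have hsn : s (n + 1) - s n = (-1) ^ n * (star (y n) * P.offDiagonal.op y n).re := by
      rw [h0]
      simp only [hs, hY, show n + 1 + 1 = n + 2 from rfl, P.a_periodic, shiftDown]
      simp only [Complex.star_def, Complex.mul_re, Complex.conj_re, Complex.conj_im,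
        Complex.add_re, Complex.add_im, Complex.mul_im, Complex.ofReal_re, Complex.ofReal_im]
      ring
    have hone : ((-1 : ℝ) ^ n) ^ 2 = 1 := by rw [← pow_mul, mul_comm, pow_mul]; norm_num
    rw [h1, hsn, ← Complex.normSq_eq_norm_sq, ← Complex.normSq_eq_norm_sq,
      ← Complex.normSq_eq_norm_sq, Complex.normSq_add, Complex.normSq_mul,
      Complex.normSq_ofReal]
    simp only [Complex.star_def, Complex.mul_re, Complex.conj_re, Complex.conj_im,
        Complex.mul_im, Complex.ofReal_re, Complex.ofReal_im]
    linear_combination P.halfDiff ^ 2 * Complex.normSq (y n) * hone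
  have hY0 : Filter.Tendsto Y Filter.atTop (𝓝 0) :=
    (Filter.tendsto_add_atTop_iff_nat 1).1 (HSeq.tendsto_zero y)
  have hslim : Filter.Tendsto s Filter.atTop (𝓝 0) := by
    have hlim : Filter.Tendsto (fun n => (P.a 0 + P.a 1) * (‖Y n‖ * ‖Y (n + 1)‖))
        Filter.atTop (𝓝 0) := by
      have := (hY0.norm.mul (HSeq.tendsto_zero y).norm).const_mul (P.a 0 + P.a 1)
      rwa [norm_zero, mul_zero, mul_zero] at this
    refine squeeze_zero_norm (fun n => ?_) hlim
    have ha : P.a (n + 1) ≤ P.a 0 + P.a 1 := by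
      have := abs_le_of_periodic P.a P.a_periodic (n + 1)
      rwa [abs_of_pos (P.a_pos _), abs_of_pos (P.a_pos _), abs_of_pos (P.a_pos _)] at this
    have hre : |(star (Y n) * Y (n + 1)).re| ≤ ‖Y n‖ * ‖Y (n + 1)‖ := by
      refine (Complex.abs_re_le_norm _).trans_eq ?_
      rw [norm_mul, norm_star]
    rw [norm_neg, norm_mul, norm_mul, norm_pow, norm_neg, norm_one, one_pow, one_mul,
      Real.norm_of_nonneg (P.a_pos _).le, Real.norm_eq_abs]
    exact mul_le_mul ha hre (abs_nonneg _) ((P.a_pos _).le.trans ha)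
  have hL := (JacobiMatrix.hasSum_normSq (T y)).tendsto_sum_nat
  have hR := (((JacobiMatrix.hasSum_normSq y).mul_left (P.halfDiff ^ 2)).add
    (JacobiMatrix.hasSum_normSq (P.offDiagonal.op y))).tendsto_sum_nat.add
    (hslim.const_mul (2 * P.halfDiff))
  rw [mul_zero, add_zero] at hR
  refine tendsto_nhds_unique hL (hR.congr fun N => ?_)
  have hs0 : s 0 = 0 := by simp [hs, hY, shiftDown]
  have hsum : ∑ n ∈ Finset.range N, (s (n + 1) - s n) = s N := by
    rw [Finset.sum_range_sub, hs0, sub_zero]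
  rw [Finset.sum_congr rfl fun n _ => hrow n, ← hsum, Finset.mul_sum, ← Finset.sum_add_distrib]

/-- The continuous spectrum lies in two bands which are symmetric about the mean of the diagonal
entries. -/
theorem normSq_sub_center_of_mem (hle : P.a 1 ≤ P.a 0) {z : ℂ}
    (hz : z ∈ continuousSpectrum P.op) :
    P.halfDiff ^ 2 + (P.a 0 - P.a 1) ^ 2 ≤ ‖z - P.center‖ ^ 2 ∧
      ‖z - P.center‖ ^ 2 ≤ P.halfDiff ^ 2 + (P.a 0 + P.a 1) ^ 2 := by
  have p0 := P.a_pos 0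
  have p1 := P.a_pos 1
  have hsplit : ∀ y : HSeq, (P.op - (P.center : ℂ) • (1 : HSeq →L[ℂ] HSeq)) y =
      (P.op - z • (1 : HSeq →L[ℂ] HSeq)) y + (z - P.center) • y := fun y => by
    change P.op y - (P.center : ℂ) • y = P.op y - z • y + (z - P.center) • y
    rw [sub_smul]
    abel
  constructor
  · by_contra! h
    set σ := √(P.halfDiff ^ 2 + (P.a 0 - P.a 1) ^ 2) with hσ
    have hlt : ‖z - P.center‖ < σ := Real.lt_sqrt_of_sq_lt h
    refine not_bounded_below_of_mem_continuousSpectrum hz (sub_pos.2 hlt) fun y => ?_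
    -- If `z` is closer to the centre than `σ`, this lower bound survives the shift to `z` and `P.op
    -- - z` is bounded below. The outer bound follows in the same way from an upper bound.
    have h1 : σ * ‖y‖ ≤ ‖(P.op - (P.center : ℂ) • (1 : HSeq →L[ℂ] HSeq)) y‖ := by
      refine abs_le_of_sq_le_sq' ?_ (norm_nonneg _) |>.2
      rw [normSq_op_sub_center, mul_pow, hσ, Real.sq_sqrt (by positivity), add_mul, ← mul_pow _ ‖y‖]
      have := P.le_norm_offDiagonal y
      have h0 : 0 ≤ (P.a 0 - P.a 1) * ‖y‖ := mul_nonneg (sub_nonneg.2 hle) (norm_nonneg _)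
      rw [← mul_pow, mul_pow P.halfDiff]
      gcongr
    rw [hsplit] at h1
    have h2 := h1.trans (norm_add_le _ _)
    rw [norm_smul] at h2
    linarith
  · by_contra! h
    set σ := √(P.halfDiff ^ 2 + (P.a 0 + P.a 1) ^ 2) with hσ
    have hlt : σ < ‖z - P.center‖ := Real.sqrt_lt' (lt_of_le_of_ne (norm_nonneg _) (by
      rintro h0
      rw [← h0] at h
      nlinarith [sq_nonneg P.halfDiff, sq_nonneg (P.a 0 + P.a 1)])) |>.2 h
    refine not_bounded_below_of_mem_continuousSpectrum hz (sub_pos.2 hlt) fun y => ?_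
    have h1 : ‖(P.op - (P.center : ℂ) • (1 : HSeq →L[ℂ] HSeq)) y‖ ≤ σ * ‖y‖ := by
      refine abs_le_of_sq_le_sq' ?_ (by positivity) |>.2
      rw [normSq_op_sub_center, mul_pow, hσ, Real.sq_sqrt (by positivity), add_mul, ← mul_pow _ ‖y‖]
      have := P.norm_offDiagonal_le y
      rw [← mul_pow, mul_pow P.halfDiff]
      gcongr
    rw [hsplit] at h1
    have h2 := norm_sub_le ((P.op - z • (1 : HSeq →L[ℂ] HSeq)) y + (z - P.center) • y)
      ((P.op - z • (1 : HSeq →L[ℂ] HSeq)) y)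
    rw [add_sub_cancel_left, norm_smul] at h2
    linarith

/-- The parameters of the matrix in terms of the ends of the bands. -/
theorem parameters_of_bands {s d : ℝ} (hs : 0 < s) (hsd : s < d)
    (hbands : continuousSpectrum P.op = Complex.ofReal '' (Set.Icc (-d) (-s) ∪ Set.Icc s d))
    (hpure : spectrum ℂ P.op = continuousSpectrum P.op) :
    P.b 1 = -P.b 0 ∧ s ^ 2 = P.b 0 ^ 2 + (P.a 0 - P.a 1) ^ 2 ∧
      d ^ 2 = P.b 0 ^ 2 + (P.a 0 + P.a 1) ^ 2 := by
  have p0 := P.a_pos 0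
  have p1 := P.a_pos 1
  have hle := P.a_one_le_a_zero hpure
  have hto : ∀ x : ℝ, P.halfDiff ^ 2 + (P.a 0 - P.a 1) ^ 2 ≤ (x - P.center) ^ 2 →
      (x - P.center) ^ 2 ≤ P.halfDiff ^ 2 + (P.a 0 + P.a 1) ^ 2 →
      x ∈ Set.Icc (-d) (-s) ∪ Set.Icc s d := by
    intro x h1 h2
    have hx : (x : ℂ) ∈ spectrum ℂ P.op := by
      refine mem_spectrum_of_abs_le ?_
      have e : (x - P.b 0) * (x - P.b 1) = (x - P.center) ^ 2 - P.halfDiff ^ 2 := by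
        rw [center, halfDiff]; ring
      rw [e, abs_le]
      constructor <;> linarith
    rw [hpure, hbands] at hx
    obtain ⟨x', hx', e⟩ := hx
    rwa [Complex.ofReal_injective e] at hx'
  have hfrom : ∀ x : ℝ, x ∈ Set.Icc (-d) (-s) ∪ Set.Icc s d →
      P.halfDiff ^ 2 + (P.a 0 - P.a 1) ^ 2 ≤ (x - P.center) ^ 2 ∧
      (x - P.center) ^ 2 ≤ P.halfDiff ^ 2 + (P.a 0 + P.a 1) ^ 2 := by
    intro x hx
    have hx' : (x : ℂ) ∈ continuousSpectrum P.op := by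
      rw [hbands]
      exact ⟨x, hx, rfl⟩
    have := normSq_sub_center_of_mem hle hx'
    rwa [← Complex.ofReal_sub, Complex.norm_real, Real.norm_eq_abs, sq_abs] at this
  set c := P.center with hc
  set σ := √(P.halfDiff ^ 2 + (P.a 0 - P.a 1) ^ 2) with hσ
  set δ := √(P.halfDiff ^ 2 + (P.a 0 + P.a 1) ^ 2) with hδ
  have hσ2 : σ ^ 2 = P.halfDiff ^ 2 + (P.a 0 - P.a 1) ^ 2 := Real.sq_sqrt (by positivity)
  have hδ2 : δ ^ 2 = P.halfDiff ^ 2 + (P.a 0 + P.a 1) ^ 2 := Real.sq_sqrt (by positivity)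
  have hσ0 : 0 ≤ σ := Real.sqrt_nonneg _
  have hδ0 : 0 ≤ δ := Real.sqrt_nonneg _
  have hσδ : σ ≤ δ := Real.sqrt_le_sqrt (by nlinarith)
  have hσδ2 : σ ^ 2 ≤ δ ^ 2 := pow_le_pow_left₀ hσ0 hσδ 2
  rw [← hσ2, ← hδ2] at hto hfrom
  have hsub : ∀ x, x ∈ Set.Icc (-d) (-s) ∪ Set.Icc s d → -d ≤ x ∧ x ≤ d := by
    rintro x (hx | hx)
    · exact ⟨hx.1, by linarith [hx.2]⟩
    · exact ⟨by linarith [hx.1], hx.2⟩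
  -- Matching the extreme points of the two descriptions of the spectrum gives `c + δ = d` and `c -
  -- δ = -d`, so `c = 0`; the inner ends then give `s = σ`.
  have e1 := (hsub (c + δ) (hto _ (by simpa using hσδ2) (by simp))).2
  have e2 := (hsub (c - δ) (hto _ (by simpa using hσδ2) (by simp))).1
  have e3 := (abs_le_of_sq_le_sq' (hfrom d (Or.inr ⟨hsd.le, le_rfl⟩)).2 hδ0).2
  have e4 := (abs_le_of_sq_le_sq' (hfrom (-d) (Or.inl ⟨le_rfl, by linarith⟩)).2 hδ0).1
  have hc0 : c = 0 := by linarith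
  have hdδ : d = δ := by linarith
  rw [hc0] at hto hfrom
  simp only [sub_zero] at hto hfrom
  have e5 : σ ≤ s := (abs_le_of_sq_le_sq' (hfrom s (Or.inr ⟨le_rfl, hsd.le⟩)).1 hs.le).2
  have e6 : s ≤ σ := by
    rcases hto σ le_rfl hσδ2 with h | h
    · linarith [h.2]
    · exact h.1
  have hsσ : s = σ := le_antisymm e6 e5
  have hb : P.b 1 = -P.b 0 := by
    have : (P.b 0 + P.b 1) / 2 = 0 := hc0
    linarith
  have hh : P.halfDiff = P.b 0 := by rw [halfDiff, hb]; ring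
  rw [hh] at hσ2 hδ2
  exact ⟨hb, by rw [hsσ, hσ2], by rw [hdδ, hδ2]⟩

end PeriodicJacobi

/-! ### Points of the bands, the constants and the conclusion. -/

theorem not_isolated_of_mem_bands {s d : ℝ} (hsd : s < d) {z : ℂ} {S : Set ℂ}
    (hz : z ∈ Complex.ofReal '' (Set.Icc (-d) (-s) ∪ Set.Icc s d))
    (hS : Complex.ofReal '' (Set.Icc (-d) (-s) ∪ Set.Icc s d) ⊆ S) :
    ¬ ∀ᶠ x in 𝓝[≠] z, x ∉ S := by
  intro h
  obtain ⟨r, hr, rfl⟩ := hz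
  have hmap : Filter.Tendsto Complex.ofReal (𝓝[≠] r) (𝓝[≠] (r : ℂ)) :=
    Complex.continuous_ofReal.continuousWithinAt.tendsto_nhdsWithin
      fun x hx h => hx (Complex.ofReal_injective h)
  have h' := hmap.eventually h
  have hacc : ∀ α β : ℝ, α < β → r ∈ Set.Icc α β →
      Set.Icc α β ⊆ Set.Icc (-d) (-s) ∪ Set.Icc s d → False := by
    intro α β hαβ hrm hsub
    have hacc : AccPt r (Filter.principal (Set.Icc α β)) :=
      (uniqueDiffOn_Icc hαβ r hrm).accPt
    have hfr := accPt_iff_frequently_nhdsNE.1 hacc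
    exact hfr (h'.mono fun x hx hxm => hx (hS ⟨x, hsub hxm, rfl⟩))
  rcases hr with hr | hr
  · exact hacc _ _ (by linarith) hr Set.subset_union_left
  · exact hacc _ _ hsd hr Set.subset_union_right

namespace PeriodicJacobi

variable {P : PeriodicJacobi}

/-- Multipliers of modulus `1` occur in the bands only. -/
theorem IsCharRoot.mem_bands {z ρ : ℂ} {s d : ℝ} (h : P.IsCharRoot z ρ) (hρ : ‖ρ‖ = 1)
    (hs : 0 < s) (hsd : s < d) (hb : P.b 1 = -P.b 0)
    (hs2 : s ^ 2 = P.b 0 ^ 2 + (P.a 0 - P.a 1) ^ 2)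
    (hd2 : d ^ 2 = P.b 0 ^ 2 + (P.a 0 + P.a 1) ^ 2) :
    z ∈ Complex.ofReal '' (Set.Icc (-d) (-s) ∪ Set.Icc s d) := by
  have p0 := P.a_pos 0
  have p1 := P.a_pos 1
  have hconj : ρ * star ρ = 1 := by
    rw [Complex.star_def, Complex.mul_conj, Complex.normSq_eq_norm_sq, hρ]
    simp
  have hre : ρ + star ρ = ((2 * ρ.re : ℝ) : ℂ) := Complex.add_conj ρ
  obtain ⟨hr1, hr2⟩ := abs_le.1 ((Complex.abs_re_le_norm ρ).trans_eq hρ)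
  set Y : ℝ := P.b 0 ^ 2 + P.a 0 ^ 2 + P.a 1 ^ 2 + P.a 0 * P.a 1 * (2 * ρ.re) with hY
  -- For a unimodular multiplier, dividing the characteristic equation by `ρ` leaves a real
  -- right-hand side, which runs between `s ^ 2` and `d ^ 2` as `ρ.re` runs from `-1` to `1`.
  have hz2 : z ^ 2 = (Y : ℂ) := by
    unfold IsCharRoot at h
    rw [hb] at h
    rw [hY]
    push_cast at h hre ⊢
    linear_combination star ρ * h + P.a 0 * P.a 1 * hre +
      (P.a 0 ^ 2 + P.a 1 ^ 2 + P.a 0 * P.a 1 * ρ - z ^ 2 + P.b 0 ^ 2) * hconj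
  have hpq : 0 < P.a 0 * P.a 1 := mul_pos p0 p1
  have hYs : s ^ 2 ≤ Y := by rw [hs2, hY]; nlinarith
  have hYd : Y ≤ d ^ 2 := by rw [hd2, hY]; nlinarith
  have hsY : s ≤ √Y := Real.le_sqrt_of_sq_le hYs
  have hYd' : √Y ≤ d := Real.sqrt_le_iff.2 ⟨by linarith, hYd⟩
  have hfac : (z - (√Y : ℝ)) * (z + (√Y : ℝ)) = 0 := by
    have : ((√Y : ℝ) : ℂ) ^ 2 = (Y : ℂ) := by
      exact_mod_cast Real.sq_sqrt ((sq_nonneg s).trans hYs)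
    linear_combination hz2 - this
  rcases mul_eq_zero.1 hfac with h1 | h1
  · exact ⟨√Y, Or.inr ⟨hsY, hYd'⟩, (sub_eq_zero.1 h1).symm⟩
  · refine ⟨-√Y, Or.inl ⟨by linarith, by linarith⟩, ?_⟩
    rw [Complex.ofReal_neg]
    exact (eq_neg_of_add_eq_zero_left h1).symm

/-- At `P.b 0` the characteristic equation factors, with roots `-P.a 0 / P.a 1` and `-P.a 1 / P.a
0`; only the second lies in the unit disc. This evaluates the factor `1 - ‖w ν‖ ^ 2` of the
hypothesis. -/
theorem IsCharRoot.norm_at_b_zero {ρ : ℂ} (h : P.IsCharRoot (P.b 0) ρ) (hρ : ‖ρ‖ ≤ 1)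
    (hlt : P.a 1 < P.a 0) : ‖ρ‖ = P.a 1 / P.a 0 := by
  have p0 := P.a_pos 0
  have p1 := P.a_pos 1
  have hne : (P.a 0 + P.a 1 * ρ : ℂ) ≠ 0 :=
    norm_pos_iff.1 ((sub_pos.2 hlt).trans_le (P.norm_add_mul_ge hρ))
  unfold IsCharRoot at h
  rw [sub_self, zero_mul, zero_mul] at h
  have h1 := (mul_eq_zero.1 h.symm).resolve_left hne
  have h2 : ‖(P.a 0 * ρ : ℂ)‖ = ‖(P.a 1 : ℂ)‖ := by
    rw [← norm_neg (P.a 1 : ℂ)]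
    congr 1
    linear_combination h1
  rw [norm_mul, Complex.norm_real, Complex.norm_real, Real.norm_of_nonneg p0.le,
    Real.norm_of_nonneg p1.le] at h2
  rw [eq_div_iff p0.ne', mul_comm]
  exact h2

/-- After cancelling `P.a 0 - P.a 1`, the relation `hdiff` turns the left side into `8 * d ^ 2 / (d
^ 2 - s ^ 2)`. Crude bounds give at least `512 * d / (d - s)` on the right. -/
theorem green_constant_le {s d : ℝ} (hs : 0 < s) (hsd : s < d) (hlt : P.a 1 < P.a 0)
    (hdiff : d ^ 2 - s ^ 2 = 4 * (P.a 0 * P.a 1)) :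
    d / P.a 0 * (2 * d / (P.a 0 - P.a 1)) / P.a 1 ≤ constK₂ s d / (1 - P.a 1 / P.a 0) := by
  have p0 := P.a_pos 0
  have p1 := P.a_pos 1
  have hd : 0 < d := hs.trans hsd
  have hds : 0 < d - s := sub_pos.2 hsd
  have h01 : 0 < P.a 0 - P.a 1 := sub_pos.2 hlt
  have hroot : √(d ^ 2 - s ^ 2) ≤ 2 * P.a 0 := by
    rw [hdiff]
    refine Real.sqrt_le_iff.2 ⟨by positivity, ?_⟩
    nlinarith
  have hroot0 : 0 < √(d ^ 2 - s ^ 2) := Real.sqrt_pos.2 (by rw [hdiff]; positivity)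
  have h2 : 1 ≤ √2 := Real.one_le_sqrt.2 (by norm_num)
  have hpow : (d - s) ^ 4 ≤ d ^ 4 := pow_le_pow_left₀ hds.le (by linarith) 4
  have hK : 512 * d / ((d - s) * P.a 0) ≤ constK₂ s d := by
    rw [constK₂, div_le_div_iff₀ (by positivity) (by positivity)]
    calc 512 * d * ((d - s) ^ 5 * √(d ^ 2 - s ^ 2))
        = 512 * d * (d - s) * ((d - s) ^ 4 * √(d ^ 2 - s ^ 2)) := by ring
      _ ≤ 512 * d * (d - s) * (d ^ 4 * (2 * P.a 0)) := by gcongr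
      _ = 1024 * 1 * d ^ 5 * ((d - s) * P.a 0) := by ring
      _ ≤ _ := by gcongr
  have e : constK₂ s d / (1 - P.a 1 / P.a 0) = constK₂ s d * P.a 0 / (P.a 0 - P.a 1) := by
    field_simp
  have e' : d / P.a 0 * (2 * d / (P.a 0 - P.a 1)) / P.a 1 =
      (2 * d ^ 2 / (P.a 0 * P.a 1)) / (P.a 0 - P.a 1) := by
    field_simp
  rw [e, e']
  gcongr
  refine le_trans ?_ (mul_le_mul_of_nonneg_right hK p0.le)
  have e'' : 512 * d / ((d - s) * P.a 0) * P.a 0 = 512 * d / (d - s) := by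
    field_simp
  rw [e'', div_le_div_iff₀ (by positivity) hds]
  nlinarith [mul_pos hd hds, mul_pos (mul_pos hd hds) hs, mul_pos (mul_pos hd hds) hd]

end PeriodicJacobi

theorem theorem1p2 (J₀ : PeriodicJacobi) (J : JacobiMatrix)
    (hcompact : IsCompactOperator (J.op - J₀.op))
    (s d : ℝ) (hs : 0 < s) (hsd : s < d)
    (hbands : continuousSpectrum J₀.op =
      Complex.ofReal '' (Set.Icc (-d) (-s) ∪ Set.Icc s d))
    (hpure : spectrum ℂ J₀.op = continuousSpectrum J₀.op)
    (hne : ∀ n, J₀.a n ≠ J₀.a (n + 1))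
    (w : ℂ → ℂ) (hw : ∀ z, ‖w z‖ ≤ 1 ∧ J₀.IsFloquetMultiplier z (w z ^ 2))
    (ν : ℝ) (hν : ν = J₀.b 0)
    (t : ℝ) (ht : 0 < t) (htexp : t * Real.exp t = 1)
    (hmoment : Summable fun n : ℕ => ((n : ℝ) + 1) * J₀.perturbation J n)
    (hsmall : constK₂ s d / (1 - ‖w (ν : ℂ)‖ ^ 2) *
      ∑' n : ℕ, ((n : ℝ) + 1) * J₀.perturbation J n < t) :
    discreteSpectrum J.op = ∅ ∧
      ∀ z : ℂ, z ∉ continuousSpectrum J₀.op →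
        ¬ Module.End.HasEigenvalue (J.op : HSeq →ₗ[ℂ] HSeq) z := by

  have hlt : J₀.a 1 < J₀.a 0 :=
    lt_of_le_of_ne (J₀.a_one_le_a_zero hpure) (hne 0).symm
  obtain ⟨hb, hs2, hd2⟩ := PeriodicJacobi.parameters_of_bands hs hsd hbands hpure
  have hchar : ∀ z, J₀.IsCharRoot z (w z ^ 2) := fun z => (hw z).2.isCharRoot
  have hdiff : d ^ 2 - s ^ 2 = 4 * (J₀.a 0 * J₀.a 1) := by rw [hd2, hs2]; ring
  have hwν : ‖w ν‖ ^ 2 = J₀.a 1 / J₀.a 0 := by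
    rw [← norm_pow]
    have h := hchar ν
    rw [hν] at h ⊢
    refine h.norm_at_b_zero ?_ hlt
    rw [norm_pow]
    exact pow_le_one₀ (norm_nonneg _) (hw _).1
  have ht1 : t < 1 := by
    have : 1 < Real.exp t := Real.one_lt_exp_iff.2 ht
    nlinarith
  rw [hwν] at hsmall
  have hsum0 : 0 ≤ ∑' n : ℕ, ((n : ℝ) + 1) * J₀.perturbation J n :=
    tsum_nonneg fun n => mul_nonneg (by positivity) (PeriodicJacobi.perturbation_nonneg n)
  have hsmall' := (mul_le_mul_of_nonneg_right
    (PeriodicJacobi.green_constant_le hs hsd hlt hdiff) hsum0).trans_lt (hsmall.trans ht1)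
  have hno : ∀ z : ℂ, z ∉ continuousSpectrum J₀.op →
      ¬ Module.End.HasEigenvalue (J.op : HSeq →ₗ[ℂ] HSeq) z := by
    intro z hz
    refine PeriodicJacobi.not_hasEigenvalue (JacobiMatrix.tendsto_upper_sub hcompact) (hchar z)
      -- A multiplier of modulus exactly `1` would place `z` in the bands.
      (lt_of_le_of_ne (hw z).1 fun h1 => hz ?_) (hs.trans hsd).le hb hd2 hlt hmoment hsmall'
    rw [hbands]
    exact (hchar z).mem_bands (by rw [norm_pow, h1, one_pow]) hs hsd hb hs2 hd2
  refine ⟨Set.eq_empty_iff_forall_notMem.2 fun z ⟨hev, _, hiso⟩ => ?_, hno⟩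
  by_cases hz : z ∈ continuousSpectrum J₀.op
  · rw [hbands] at hz
    refine not_isolated_of_mem_bands hsd hz ?_ hiso
    rw [← hbands]
    exact fun x hx => mem_spectrum_of_mem_continuousSpectrum hcompact hx
  · exact hno z hz hev
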